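/- **Words.** A *prefix-shuffle* is a word $w$ on $\{a,\bar a,b,\bar b\}$ such that every prefix $w'$ of $w$ satisfies $|w'|_a\ge|w'|_{\bar a}$ and $|w'|_b\ge|w'|_{\bar b}$. For $c\in\{a,b\}$, an occurrence of $c$ is *paired* with a later occurrence of $\bar c$ if the subword of letters $c,\bar c$ lying strictly between them is a parenthesis system. Let $w^+$ be $w$ followed by $|w|_a-|w|_{\bar a}$ letters $\bar a$. **Prefix-map.** Maps are rooted, the root being a half-edge that is regarded as a head; a *(planted plane) tree* is a rooted planar map with a single face. The tour of a tree follows its border counterclockwise from the root. Let $T_w$ be the tree such that writing $a$ the first time and $\bar a$ the second time an edge is followed during the tour gives the subword of $w^+$ on $a,\bar a$; orient its edges away from the root. The *prefix-map* $M_w$ is the oriented map obtained from $T_w$ by inserting, while making the tour according to $w$, a head for every $b$ and a tail for every $\bar b$, and by joining the head and tail of paired $b,\bar b$ into an edge. The heads of the non-paired letters $b$ are the *dangling heads*. The edges of $T_w$ whose letter $a$ is not paired in $w$ are *active*; the *rooting heads* are the root, which comes first, and the heads of the active edges. Dangling heads and active edges (hence rooting heads) are ordered by their appearance during the tour of $T_w$.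 **Prefix-forest.** $F_w$ is obtained from $M_w$ by deleting the tails of the active edges and then applying the vertex explosion: each vertex is replaced by as many vertices as it has incident heads, each tail becoming adjacent only to the first head encountered counterclockwise around the vertex starting from that tail, and cyclic orders being preserved. **Tree-sequences.** Let $\tau$ be the tree reduced to a root and a vertex, and let $\sigma(T_1,T_2)$ be the tree obtained from $T_2$ by adding an edge from its root-vertex to $T_1$ (the root of $T_1$ becoming the head of this edge), placed as the first edge encountered clockwise around the root-vertex of $T_2$ starting from its root. The word $\lambda_0(w)$ on the letters $u,v$ and all trees is defined recursively: $\lambda_0(\epsilon)=u\tau v$; $\lambda_0(w'a)$ is obtained from $\lambda_0(w')$ by replacing the last $u$ by $u\tau v$; $\lambda_0(w'b)$ by replacing the first $v$ by $u\tau v$; $\lambda_0(w'\bar a)$ by replacing the factor $T_1vT_2$ around the first $v$ by $\sigma(T_1,T_2)$; $\lambda_0(w'\bar b)$ by replacing the factor $T_1uT_2$ around the last $u$ by $\sigma(T_1,T_2)$. **Proposition.** Let $w$ be a prefix-shuffle, and let $h_1<\cdots<h_k$ be the dangling heads and $h'_1<\cdots<h'_l$ the rooting heads of $M_w$, in order of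 appearance. Then $F_w$ is a forest consisting of exactly $k+l$ trees $t_1,\dots,t_k,t'_1,\dots,t'_l$ (its connected components), the root of $t_i$ being $h_i$ and the root of $t'_i$ being $h'_i$. Moreover $$\lambda_0(w)=u\,t_1\,u\cdots u\,t_k\,u\,t'_l\,v\cdots v\,t'_1\,v .$$ -/

import Mathlib

namespace PrefixShuffle

/-! # Words -/

/-- The alphabet `{a, ā, b, b̄}`. -/
inductive Letter
  | a | aBar | b | bBar
  deriving DecidableEq

/-- For all prefixes `p` of `w`, `|p|_a ≥ |p|_ā` and `|p|_b ≥ |p|_b̄`. -/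
def IsPrefixShuffle (w : List Letter) : Prop :=
  ∀ p ∈ w.inits, p.count .aBar ≤ p.count .a ∧ p.count .bBar ≤ p.count .b

/-- A word `s` on the two letters `c`, `d` is a parenthesis system (`c` opens, `d` closes). -/
def IsParenSystem (c d : Letter) (s : List Letter) : Prop :=
  (∀ x ∈ s, x = c ∨ x = d) ∧ s.count c = s.count d ∧ ∀ p ∈ s.inits, p.count d ≤ p.count c

instance (c d : Letter) (s : List Letter) : Decidable (IsParenSystem c d s) := by
  unfold IsParenSystem; infer_instance

/-- The subword, on the letters `c` and `d`, of the letters of `s` lying strictly between the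
positions `i` and `j` (positions are numbered from `0`). -/
def between (c d : Letter) (s : List Letter) (i j : ℕ) : List Letter :=
  ((s.take j).drop (i + 1)).filter (fun x => decide (x = c ∨ x = d))

/-- The occurrence of `c` at position `i` of `s` is paired with the occurrence of `d` (the letter
`c̄`) at position `j`. -/
def Paired (c d : Letter) (s : List Letter) (i j : ℕ) : Prop :=
  i < j ∧ s[i]? = some c ∧ s[j]? = some d ∧ IsParenSystem c d (between c d s i j)

instance (c d : Letter) (s : List Letter) (i j : ℕ) : Decidable (Paired c d s i j) := by
  unfold Paired; infer_instance

/-- The letter at position `i` of `s` is an occurrence of `c` that is not paired. -/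
def NonPaired (c d : Letter) (s : List Letter) (i : ℕ) : Prop :=
  s[i]? = some c ∧ ∀ j ∈ List.range s.length, ¬ Paired c d s i j

instance (c d : Letter) (s : List Letter) (i : ℕ) : Decidable (NonPaired c d s i) := by
  unfold NonPaired; infer_instance

/-- The word `w⁺`: `w` followed by `|w|_a - |w|_ā` letters `ā`. -/
def plus (w : List Letter) : List Letter :=
  w ++ List.replicate (w.count .a - w.count .aBar) .aBar

/-! # Oriented maps -/

/-- An oriented map given by its rotation system. The half-edge following `x` in counterclockwise
direction around its vertex is `next x`, so that the vertices are the cycles of `next`; the other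
half of the edge carrying `x` is `mate x`, with `mate x = x` when `x` is a half-edge that does not
belong to an edge (the root, or a dangling half-edge). Every half-edge is a head or a tail, and
an edge is made of a head and a tail. -/
structure OrientedMap where
  HalfEdge : Type
  [finite : Finite HalfEdge]
  [decEq : DecidableEq HalfEdge]
  next : Equiv.Perm HalfEdge
  mate : Equiv.Perm HalfEdge
  isHead : HalfEdge → Bool
  mate_mate : ∀ x, mate (mate x) = x
  isHead_mate : ∀ x, mate x ≠ x → isHead (mate x) = !isHead x

attribute [instance] OrientedMap.finite OrientedMap.decEq

theorem exists_return {H : Type} [Finite H] (ρ : Equiv.Perm H) (x : H) :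
    ∃ k, 1 ≤ k ∧ (ρ ^ k) x = x :=
  ⟨orderOf ρ, orderOf_pos ρ, by simp [pow_orderOf_eq_one]⟩

section firstReturn

variable {H L : Type} [Finite H]

theorem exists_return_label (ρ : Equiv.Perm H) (f : H → L) (x : H) :
    ∃ k, 1 ≤ k ∧ f ((ρ ^ k) x) = f x := by
  obtain ⟨k, hk, h⟩ := exists_return ρ x
  exact ⟨k, hk, by rw [h]⟩

variable [DecidableEq L]

/-- The first element met after `x` along the cycle of `x` under `ρ` that has the same label
as `x`. -/
def firstReturnFun (ρ : Equiv.Perm H) (f : H → L) (x : H) : H :=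
  (ρ ^ Nat.find (exists_return_label ρ f x)) x

theorem label_firstReturnFun (ρ : Equiv.Perm H) (f : H → L) (x : H) :
    f (firstReturnFun ρ f x) = f x :=
  (Nat.find_spec (exists_return_label ρ f x)).2

theorem firstReturnFun_aux (ρ : Equiv.Perm H) (f : H → L) (x y : H)
    (h : firstReturnFun ρ f x = firstReturnFun ρ f y)
    (hle : Nat.find (exists_return_label ρ f x) ≤ Nat.find (exists_return_label ρ f y)) :
    x = y := by
  have hf : f x = f y := by
    rw [← label_firstReturnFun ρ f x, ← label_firstReturnFun ρ f y, h]
  have hmin := fun m => Nat.find_min (exists_return_label ρ f y) (m := m)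
  have hx1 := (Nat.find_spec (exists_return_label ρ f x)).1
  unfold firstReturnFun at h
  generalize Nat.find (exists_return_label ρ f x) = k at *
  generalize Nat.find (exists_return_label ρ f y) = m at *
  obtain ⟨d, rfl⟩ := Nat.exists_eq_add_of_le hle
  rw [pow_add, Equiv.Perm.mul_apply] at h
  have hxy : x = (ρ ^ d) y := (ρ ^ k).injective h
  rcases Nat.eq_zero_or_pos d with rfl | hd
  · simpa using hxy
  · exact absurd ⟨hd, by rw [← hxy, hf]⟩ (hmin d (by omega))

theorem firstReturnFun_injective (ρ : Equiv.Perm H) (f : H → L) :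
    Function.Injective (firstReturnFun ρ f) := by
  intro x y h
  rcases le_total (Nat.find (exists_return_label ρ f x)) (Nat.find (exists_return_label ρ f y))
    with hle | hle
  · exact firstReturnFun_aux ρ f x y h hle
  · exact (firstReturnFun_aux ρ f y x h.symm hle).symm

/-- The permutation obtained from `ρ` by cutting its cycles into the classes of equal label, each
class of each cycle keeping the cyclic order. -/
noncomputable def firstReturn (ρ : Equiv.Perm H) (f : H → L) : Equiv.Perm H :=
  Equiv.ofBijective (firstReturnFun ρ f)
    (Finite.injective_iff_bijective.mp (firstReturnFun_injective ρ f))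

theorem label_firstReturn (ρ : Equiv.Perm H) (f : H → L) (x : H) :
    f (firstReturn ρ f x) = f x :=
  label_firstReturnFun ρ f x

end firstReturn

/-- The permutation attached to an involution. -/
def involutionPerm {H : Type} (m : H → H) (h : ∀ x, m (m x) = x) : Equiv.Perm H :=
  Function.Involutive.toPerm m h

theorem involutionPerm_apply {H : Type} (m : H → H) (h : ∀ x, m (m x) = x) (x : H) :
    involutionPerm m h x = m x :=
  rfl

namespace OrientedMap

/-- Deleting the half-edges `x` with `p x = true`. The others keep their cyclic order around
their vertex, and a half-edge whose mate is deleted becomes dangling. -/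
noncomputable def delete (M : OrientedMap) (p : M.HalfEdge → Bool) : OrientedMap where
  HalfEdge := {x : M.HalfEdge // p x = false}
  next := (firstReturn M.next p).subtypePerm (fun x => by rw [label_firstReturn M.next p x])
  mate := involutionPerm (fun x => if h : p (M.mate x.1) = false then ⟨M.mate x.1, h⟩ else x) (by
    intro x
    by_cases h : p (M.mate x.1) = false
    · have hx : p (M.mate (M.mate x.1)) = false := by rw [M.mate_mate]; exact x.2
      simp only [dif_pos h, dif_pos hx]
      exact Subtype.ext (M.mate_mate x.1)
    · simp only [dif_neg h])
  isHead := fun x => M.isHead x.1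
  mate_mate := by
    intro x
    exact Function.Involutive.toPerm_involutive _ x
  isHead_mate := by
    intro x hx
    rw [involutionPerm_apply] at hx ⊢
    by_cases h : p (M.mate x.1) = false
    · rw [dif_pos h] at hx ⊢
      exact M.isHead_mate x.1 (fun e => hx (Subtype.ext e))
    · exact absurd (dif_neg h) hx

theorem exists_head (M : OrientedMap) (x : M.HalfEdge) :
    ∃ k, M.isHead ((M.next ^ k) x) = true ∨ (1 ≤ k ∧ (M.next ^ k) x = x) := by
  obtain ⟨k, hk⟩ := exists_return M.next x
  exact ⟨k, Or.inr hk⟩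

/-- The first head encountered in counterclockwise direction around the vertex of `x` starting
from `x` (it is `x` when `x` is a head; the value is `x` too when the vertex has no head). -/
def firstHead (M : OrientedMap) (x : M.HalfEdge) : M.HalfEdge :=
  (M.next ^ Nat.find (M.exists_head x)) x

/-- The vertex explosion process: each vertex is replaced by as many vertices as it has heads, and
a tail is adjacent to the first head encountered in counterclockwise direction starting from it.
Around each of the new vertices the half-edges keep their cyclic order. -/
noncomputable def explode (M : OrientedMap) : OrientedMap where
  HalfEdge := M.HalfEdge
  next := firstReturn M.next M.firstHead
  mate := M.mate
  isHead := M.isHead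
  mate_mate := M.mate_mate
  isHead_mate := M.isHead_mate

/-- Two half-edges lie in the same connected component. -/
def Joined (M : OrientedMap) (x y : M.HalfEdge) : Prop :=
  Relation.EqvGen (fun x y => y = M.next x ∨ y = M.mate x) x y

theorem joined_next_iff (M : OrientedMap) (r x : M.HalfEdge) :
    M.Joined r (M.next x) ↔ M.Joined r x :=
  ⟨fun h => h.trans _ _ _ (.symm _ _ (.rel _ _ (Or.inl rfl))),
    fun h => h.trans _ _ _ (.rel _ _ (Or.inl rfl))⟩

theorem joined_mate_iff (M : OrientedMap) (r x : M.HalfEdge) :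
    M.Joined r (M.mate x) ↔ M.Joined r x :=
  ⟨fun h => h.trans _ _ _ (.symm _ _ (.rel _ _ (Or.inr rfl))),
    fun h => h.trans _ _ _ (.rel _ _ (Or.inr rfl))⟩

/-- The connected component of the half-edge `r`. -/
def component (M : OrientedMap) (r : M.HalfEdge) : OrientedMap where
  HalfEdge := {x : M.HalfEdge // M.Joined r x}
  next := M.next.subtypePerm (M.joined_next_iff r)
  mate := M.mate.subtypePerm (M.joined_mate_iff r)
  isHead := fun x => M.isHead x.1
  mate_mate := fun x => Subtype.ext (M.mate_mate x.1)
  isHead_mate := fun x hx => M.isHead_mate x.1 (fun e => hx (Subtype.ext e))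

/-- The half-edge `r`, in its component. -/
def componentRoot (M : OrientedMap) (r : M.HalfEdge) : (M.component r).HalfEdge :=
  ⟨r, Relation.EqvGen.refl r⟩

/-- Number of vertices: cycles of `next`. -/
noncomputable def numVertices (M : OrientedMap) : ℕ :=
  Nat.card (Quotient (Equiv.Perm.SameCycle.setoid M.next))

/-- Number of edges (each has exactly one head). -/
noncomputable def numEdges (M : OrientedMap) : ℕ :=
  Nat.card {x : M.HalfEdge // M.isHead x = true ∧ M.mate x ≠ x}

/-- Number of faces: cycles of the permutation `x ↦ next (mate x)`, which follows the borders of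
the faces. -/
noncomputable def numFaces (M : OrientedMap) : ℕ :=
  Nat.card (Quotient (Equiv.Perm.SameCycle.setoid (M.next * M.mate)))

/-- The map `M`, rooted at the half-edge `r`, is a tree: a connected planar map (planarity being
Euler's relation) with a single face, in which `r` is the only half-edge not belonging to an
edge. -/
structure IsTree (M : OrientedMap) (r : M.HalfEdge) : Prop where
  connected : ∀ x, M.Joined r x
  root : ∀ x, M.mate x = x ↔ x = r
  planar : M.numVertices + M.numFaces = M.numEdges + 2
  single_face : M.numFaces = 1

end OrientedMap

/-! # Planted plane trees and the mapping `λ₀` -/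

/-- Planted plane trees: a root-vertex together with the list of the subtrees hanging from its
sons, in their order of appearance around the tree, i.e. in counterclockwise order around the
root-vertex starting from the root. -/
inductive PlaneTree
  | node (sons : List PlaneTree)

/-- The tree reduced to a root and a vertex. -/
def PlaneTree.τ : PlaneTree := .node []

/-- The tree `σ(T₁, T₂)`: a new edge joins the root-vertex of `T₂` to `T₁`, whose root becomes the
head of that edge. This edge is the first one encountered in clockwise order around the root-vertex
of `T₂` starting from the root, i.e. `T₁` becomes the last subtree. -/
def PlaneTree.σ : PlaneTree → PlaneTree → PlaneTree
  | T₁, .node sons => .node (sons ++ [T₁])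

/-- `M.HasShape r t`: exploring the map `M` from the half-edge `r` one finds the planted plane
tree `t`. Counterclockwise around the vertex of `r` there are `r` and then one half-edge per
son of the root-vertex of `t`, and the other half of the `i`-th of these edges is the
root of the `i`-th subtree of `t`. -/
inductive OrientedMap.HasShape (M : OrientedMap) : M.HalfEdge → PlaneTree → Prop
  | node (r : M.HalfEdge) (ts : List PlaneTree)
      (degree : Function.minimalPeriod M.next r = ts.length + 1)
      (edges : ∀ i < ts.length, M.mate ((M.next ^ (i + 1)) r) ≠ (M.next ^ (i + 1)) r)
      (subtrees : ∀ (i : ℕ) (hi : i < ts.length),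
        OrientedMap.HasShape M (M.mate ((M.next ^ (i + 1)) r)) ts[i]) :
      OrientedMap.HasShape M r (.node ts)

/-- The connected component of `r` in `M`, rooted at `r`, is the planted plane tree `t`. -/
def OrientedMap.IsTreeAt (M : OrientedMap) (r : M.HalfEdge) (t : PlaneTree) : Prop :=
  (M.component r).IsTree (M.componentRoot r) ∧ (M.component r).HasShape (M.componentRoot r) t

/-- The letters of tree-sequences: `u`, `v`, and all trees. -/
inductive Symb
  | u | v | tree (T : PlaneTree)

/-- Does the letter `u` occur? -/
def hasU : List Symb → Bool
  | [] => false
  | .u :: _ => true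
  | _ :: s => hasU s

/-- Replace the last occurrence of `u` by `u τ v`. -/
def replaceLastU : List Symb → List Symb
  | [] => []
  | .u :: s => if hasU s then .u :: replaceLastU s else .u :: .tree .τ :: .v :: s
  | x :: s => x :: replaceLastU s

/-- Replace the first occurrence of `v` by `u τ v`. -/
def replaceFirstV : List Symb → List Symb
  | [] => []
  | .v :: s => .u :: .tree .τ :: .v :: s
  | x :: s => x :: replaceFirstV s

/-- Replace by `σ(T₁, T₂)` the subword `T₁ v T₂` around the first occurrence of `v`. -/
def mergeFirstV : List Symb → List Symb
  | [] => []
  | .tree T₁ :: .v :: .tree T₂ :: s => .tree (PlaneTree.σ T₁ T₂) :: s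
  | .v :: s => .v :: s
  | x :: s => x :: mergeFirstV s

/-- Replace by `σ(T₁, T₂)` the subword `T₁ u T₂` around the last occurrence of `u`. -/
def mergeLastU : List Symb → List Symb
  | [] => []
  | .tree T₁ :: .u :: .tree T₂ :: s =>
      if hasU s then .tree T₁ :: mergeLastU (.u :: .tree T₂ :: s)
      else .tree (PlaneTree.σ T₁ T₂) :: s
  | x :: s => x :: mergeLastU s

/-- The tree-sequence of `w' α` from that of `w'`. -/
def lambda0Step (s : List Symb) : Letter → List Symb
  | .a => replaceLastU s
  | .b => replaceFirstV s
  | .aBar => mergeFirstV s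
  | .bBar => mergeLastU s

/-- The mapping `λ₀`, read letter by letter from the left: `λ₀(ε) = u τ v`, and `λ₀(w' α)` is
`lambda0Step (λ₀(w')) α`. -/
def lambda0 (w : List Letter) : List Symb :=
  w.foldl lambda0Step [.u, .tree .τ, .v]

/-! # Prefix-maps -/

/-- The half-edges of the prefix-map of `w`, numbered by the time at which they are encountered
during the tour of the spanning tree, in which the word `w⁺` is written. The half-edge `0` is the
root, and `j + 1` is the half-edge encountered when the letter at position `j` of `w⁺` is written:
the tail of an edge of the tree for `a`, its head for the corresponding `ā`, a head not in the tree
for `b` and a tail not in the tree for `b̄`. -/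
abbrev HalfEdges (w : List Letter) : Type := Fin ((plus w).length + 1)

/-- The letter of `w⁺` written when `x` is encountered; there is none for the root. -/
def letterAt (w : List Letter) (x : HalfEdges w) : Option Letter :=
  if x.val = 0 then none else (plus w)[x.val - 1]?

/-- The letters written at `x` and `y`, or at `y` and `x`, are a paired `c` and `d = c̄` of
`w⁺`. -/
def Linked (c d : Letter) (w : List Letter) (x y : HalfEdges w) : Prop :=
  0 < x.val ∧ 0 < y.val ∧
    (Paired c d (plus w) (x.val - 1) (y.val - 1) ∨ Paired c d (plus w) (y.val - 1) (x.val - 1))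

instance (c d : Letter) (w : List Letter) (x y : HalfEdges w) : Decidable (Linked c d w x y) := by
  unfold Linked; infer_instance

/-- The element related to `x`, or `x` if there is none. -/
def partner {n : ℕ} (R : Fin n → Fin n → Prop) [DecidableRel R] (x : Fin n) : Fin n :=
  ((List.finRange n).find? (fun y => decide (R x y))).getD x

theorem partner_spec {n : ℕ} (R : Fin n → Fin n → Prop) [DecidableRel R] (x : Fin n) :
    R x (partner R x) ∨ ((∀ y, ¬ R x y) ∧ partner R x = x) := by
  unfold partner
  cases h : (List.finRange n).find? (fun y => decide (R x y)) with
  | none =>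
    right
    rw [List.find?_eq_none] at h
    exact ⟨fun y => by simpa using h y (List.mem_finRange y), rfl⟩
  | some y =>
    left
    simpa using List.find?_some h

theorem partner_partner {n : ℕ} (R : Fin n → Fin n → Prop) [DecidableRel R]
    (hs : ∀ x y, R x y → R y x) (hu : ∀ x y z, R x y → R x z → y = z) (x : Fin n) :
    partner R (partner R x) = x := by
  rcases partner_spec R x with h | ⟨h, e⟩
  · rcases partner_spec R (partner R x) with h' | ⟨h', -⟩
    · exact hu _ _ _ h' (hs _ _ h)
    · exact absurd (hs _ _ h) (h' _)
  · rw [e, e]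

theorem Linked.symm {c d : Letter} {w : List Letter} {x y : HalfEdges w}
    (h : Linked c d w x y) : Linked c d w y x :=
  ⟨h.2.1, h.1, h.2.2.symm⟩

theorem between_split {c d : Letter} {s : List Letter} {i k j : ℕ} {l : Letter}
    (hik : i < k) (hkj : k < j) (hk : s[k]? = some l) (hl : l = c ∨ l = d) :
    between c d s i j = between c d s i k ++ l :: between c d s k j := by
  obtain ⟨hlt, rfl⟩ := List.getElem?_eq_some_iff.mp hk
  have h1 : s.take j = s.take k ++ s[k] :: (s.take j).drop (k + 1) := by
    conv_lhs => rw [← List.take_append_drop k (s.take j)]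
    rw [List.take_take, min_eq_left hkj.le,
      List.drop_eq_getElem_cons (by simp; omega), List.getElem_take]
  have h2 : (s.take j).drop (i + 1) =
      (s.take k).drop (i + 1) ++ s[k] :: (s.take j).drop (k + 1) := by
    conv_lhs => rw [h1]
    rw [List.drop_append_of_le_length (by simp; omega)]
  unfold between
  rw [h2, List.filter_append, List.filter_cons_of_pos (by simpa using hl)]

theorem Paired.unique_right {c d : Letter} (hcd : c ≠ d) {s : List Letter} {i j k : ℕ}
    (hj : Paired c d s i j) (hk : Paired c d s i k) : j = k := by
  have aux : ∀ {j k : ℕ}, Paired c d s i j → Paired c d s i k → ¬ j < k := by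
    intro j k hj hk hlt
    have e := between_split (c := c) (d := d) hj.1 hlt hj.2.2.1 (Or.inr rfl)
    have hp := hk.2.2.2.2.2 (between c d s i j ++ [d]) (by
      rw [List.mem_inits, e]; exact ⟨between c d s j k, by simp⟩)
    have hc := hj.2.2.2.2.1
    simp [List.count_append, Ne.symm hcd] at hp
    omega
  rcases lt_trichotomy j k with h | h | h
  · exact absurd h (aux hj hk)
  · exact h
  · exact absurd h (aux hk hj)

theorem Paired.unique_left {c d : Letter} (hcd : c ≠ d) {s : List Letter} {i j k : ℕ}
    (hi : Paired c d s i k) (hj : Paired c d s j k) : i = j := by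
  have aux : ∀ {i j : ℕ}, Paired c d s i k → Paired c d s j k → ¬ i < j := by
    intro i j hi hj hlt
    have e := between_split (c := c) (d := d) hlt hj.1 hj.2.1 (Or.inl rfl)
    have hp := hi.2.2.2.2.2 (between c d s i j) (by
      rw [List.mem_inits, e]; exact List.prefix_append _ _)
    have hc := hi.2.2.2.2.1
    have hc' := hj.2.2.2.2.1
    rw [e] at hc
    simp [List.count_append, hcd] at hc
    omega
  rcases lt_trichotomy i j with h | h | h
  · exact absurd h (aux hi hj)
  · exact h
  · exact absurd h (aux hj hi)

theorem Linked.unique {c d : Letter} (hcd : c ≠ d) {w : List Letter} {x y z : HalfEdges w}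
    (hy : Linked c d w x y) (hz : Linked c d w x z) : y = z := by
  obtain ⟨hx0, hy0, hy⟩ := hy
  obtain ⟨-, hz0, hz⟩ := hz
  apply Fin.ext
  rcases hy with hy | hy <;> rcases hz with hz | hz
  · have := hy.unique_right hcd hz; omega
  · have h := hy.2.1.symm.trans hz.2.2.1; simp [hcd] at h
  · have h := hz.2.1.symm.trans hy.2.2.1; simp [hcd] at h
  · have := hy.unique_left hcd hz; omega

theorem Linked.letterAt {c d : Letter} {w : List Letter} {x y : HalfEdges w}
    (h : Linked c d w x y) :
    (letterAt w x = some c ∧ letterAt w y = some d) ∨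
      (letterAt w x = some d ∧ letterAt w y = some c) := by
  obtain ⟨hx, hy, h⟩ := h
  simp only [PrefixShuffle.letterAt, hx.ne', hy.ne', if_false]
  rcases h with h | h
  · exact Or.inl ⟨h.2.1, h.2.2.1⟩
  · exact Or.inr ⟨h.2.2.1, h.2.1⟩

/-- The matching of the half-edges of the spanning tree: an `a` of `w⁺` with the paired `ā`. -/
def treeMate (w : List Letter) : Equiv.Perm (HalfEdges w) :=
  involutionPerm (partner (Linked .a .aBar w))
    (partner_partner _ (fun _ _ h => h.symm) (fun _ _ _ => Linked.unique (by decide)))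

/-- The two letters at `x` and `y` are paired in `w⁺`. -/
def LinkedAny (w : List Letter) (x y : HalfEdges w) : Prop :=
  Linked .a .aBar w x y ∨ Linked .b .bBar w x y

instance (w : List Letter) (x y : HalfEdges w) : Decidable (LinkedAny w x y) := by
  unfold LinkedAny; infer_instance

theorem LinkedAny.unique {w : List Letter} (x y z : HalfEdges w)
    (hy : LinkedAny w x y) (hz : LinkedAny w x z) : y = z := by
  rcases hy with hy | hy <;> rcases hz with hz | hz
  · exact hy.unique (by decide) hz
  · rcases hy.letterAt with h | h <;> rcases hz.letterAt with h' | h' <;>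
      simp [h.1] at h'
  · rcases hy.letterAt with h | h <;> rcases hz.letterAt with h' | h' <;>
      simp [h.1] at h'
  · exact hy.unique (by decide) hz

/-- Is the half-edge at which this letter is written a head? The root is a head. -/
def headLetter : Option Letter → Bool
  | none => true
  | some .a => false
  | some .aBar => true
  | some .b => true
  | some .bBar => false

/-- The prefix-map `M_w`. During the tour of the spanning tree (counterclockwise around the tree),
after a half-edge `x` one encounters `next (treeMate x)`: an edge of the tree is followed, and a
half-edge not in the tree is crossed. As the half-edges are numbered in the order of the tour, this
is `x + 1` (cyclically), i.e. `next (treeMate x) = finRotate _ x`. -/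
def prefixMap (w : List Letter) : OrientedMap where
  HalfEdge := HalfEdges w
  next := finRotate _ * treeMate w
  mate := involutionPerm (partner (LinkedAny w))
    (partner_partner _ (fun _ _ h => h.imp Linked.symm Linked.symm) LinkedAny.unique)
  isHead := fun x => headLetter (letterAt w x)
  mate_mate := fun x => Function.Involutive.toPerm_involutive _ x
  isHead_mate := by
    intro x hx
    rw [involutionPerm_apply] at hx ⊢
    rcases partner_spec (LinkedAny w) x with (h | h) | ⟨-, h⟩
    · rcases h.letterAt with h | h <;> simp [h.1, h.2, headLetter]
    · rcases h.letterAt with h | h <;> simp [h.1, h.2, headLetter]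
    · exact absurd h hx

/-- The tails of the active edges, i.e. of the edges of the tree whose letter `a` is not paired
in `w`. -/
def isActiveTail (w : List Letter) (x : HalfEdges w) : Bool :=
  decide (0 < x.val ∧ NonPaired .a .aBar w (x.val - 1))

/-- The dangling heads, i.e. the heads whose letter `b` is not paired in `w`. -/
def isDanglingHead (w : List Letter) (x : HalfEdges w) : Bool :=
  decide (0 < x.val ∧ NonPaired .b .bBar w (x.val - 1))

/-- The dangling heads `h_1 < ⋯ < h_k` in their order of appearance. -/
def danglingHeads (w : List Letter) : List (HalfEdges w) :=
  (List.finRange _).filter (isDanglingHead w)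

/-- The rooting heads `h'_1 < ⋯ < h'_l`: the root, and then the heads of the active edges, in the
order of appearance of these edges (an edge appears when its tail is encountered). -/
def rootingHeads (w : List Letter) : List (HalfEdges w) :=
  0 :: ((List.finRange _).filter (isActiveTail w)).map (treeMate w)

/-- The prefix-forest `F_w`: delete the tails of the active edges of `M_w`, then apply the vertex
explosion process. -/
noncomputable def prefixForest (w : List Letter) : OrientedMap :=
  ((prefixMap w).delete (isActiveTail w)).explode

/-- The half-edge of `M_w` from which a half-edge of `F_w` comes. -/
def origin (w : List Letter) (x : (prefixForest w).HalfEdge) : HalfEdges w :=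
  Subtype.val (p := fun y : HalfEdges w => isActiveTail w y = false) x

/-- The word `u t_1 u ⋯ u t_k u t'_l v ⋯ v t'_1 v`. -/
def treeSequence (ts ts' : List PlaneTree) : List Symb :=
  ts.flatMap (fun t => [.u, .tree t]) ++ .u :: ts'.reverse.flatMap (fun t => [.tree t, .v])

end PrefixShuffle

namespace PrefixShuffle

/-! # Tree-sequences -/

/-! The mapping `lambda0` carries out the tour of the spanning tree. During the tour two stacks are
recorded: the letters `b` still waiting for their `b̄` (`stack`), and the open corners (`corner`),
one for the root and one for each tree edge followed only once, each with the tails met at its end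
since the last head there. Explosion gives a tail to the first head that follows it, so a head owns
exactly the tails found in the top corner when it is met; these are its `kids` (`isCorners_kids`).

The invariant `lambda0_take` identifies the two groups of trees in the tree-sequence with the trees
of the waiting heads `b` and the trees growing in the open corners. Each letter acts on both sides
alike: `a` opens an empty corner; `b` turns the tails of the top corner into a finished tree and
starts afresh; `ā` finishes the top tree and hangs it, by the tail `a`, on the corner below; `b̄`
hangs the tree of the last waiting `b` on the top corner. No partial forest is needed: the tails
owned by a head lead to heads met earlier, so shapes can be asserted in the final forest from the
start. At the end of `w` some corners are still open, but the letters `ā` completing `w⁺` add only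
tails of active edges, which are deleted (`keep_kids_treeMate`). The growing trees are therefore
those of the rooting heads.

It remains to see that these shapes are the components. After explosion every vertex has one head
(`uniqueHeads_explode`). The recursive exploration of a shape follows a single face border and is
closed under both permutations (`HasShape.tour`), so it fills its component and leaves only the root
without an edge. Then there is one more head, hence one more vertex, than there are edges, and
Euler's relation follows. Two roots cannot share a component, since a tree has one dangling
half-edge. Conversely, a head that is not a root is joined to a head met strictly later
(`time_lt_of_mem_kids`), so every half-edge is joined to a root. -/

theorem hasU_append_cons_u (P Q : List Symb) : hasU (P ++ .u :: Q) = true := by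
  induction P with
  | nil => rfl
  | cons x P ih => cases x <;> simp_all [hasU]

theorem hasU_flatMap_tree_v (ts : List PlaneTree) :
    hasU (ts.flatMap fun t => [Symb.tree t, .v]) = false := by
  induction ts with
  | nil => rfl
  | cons t ts ih => simpa [hasU] using ih

theorem replaceLastU_append (P Q : List Symb) (hQ : hasU Q = false) :
    replaceLastU (P ++ .u :: Q) = P ++ .u :: .tree .τ :: .v :: Q := by
  induction P with
  | nil => simp [replaceLastU, hQ]
  | cons x P ih => cases x <;> simp_all [replaceLastU, hasU_append_cons_u]

theorem replaceFirstV_append (P Q : List Symb) (hP : .v ∉ P) :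
    replaceFirstV (P ++ .v :: Q) = P ++ .u :: .tree .τ :: .v :: Q := by
  induction P with
  | nil => rfl
  | cons x P ih => cases x <;> simp_all [replaceFirstV]

theorem mergeFirstV_append (P Q : List Symb) (T₁ T₂ : PlaneTree) (hP : .v ∉ P) :
    mergeFirstV (P ++ .tree T₁ :: .v :: .tree T₂ :: Q) = P ++ .tree (.σ T₁ T₂) :: Q := by
  induction P with
  | nil => rfl
  | cons x P ih =>
    have hP' : Symb.v ∉ P := fun h => hP (List.mem_cons_of_mem _ h)
    cases x with
    | u => simp [mergeFirstV, ih hP']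
    | v => simp at hP
    | tree T =>
      rw [List.cons_append, List.cons_append, ← ih hP', mergeFirstV]
      -- The merging rule cannot fire at this earlier tree: the next symbol lies in `P`, hence is
      -- not `v`, or is `T₁`.
      · intro _ _ _ _ h
        cases P with
        | nil => simp at h
        | cons y P => cases y <;> simp_all
      · simp

theorem mergeLastU_append (P Q : List Symb) (T₁ T₂ : PlaneTree) (hQ : hasU Q = false) :
    mergeLastU (P ++ .tree T₁ :: .u :: .tree T₂ :: Q) = P ++ .tree (.σ T₁ T₂) :: Q := by
  induction P with
  | nil => simp [mergeLastU, hQ]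
  | cons x P ih =>
    rw [List.cons_append, List.cons_append, ← ih]
    by_cases hx : ∃ T T' s, x = .tree T ∧
        P ++ .tree T₁ :: .u :: .tree T₂ :: Q = .u :: .tree T' :: s
    · obtain ⟨T, T', s, rfl, h⟩ := hx
      -- The `u` singled out in the statement comes later, so the rule must pass over this one.
      have hs : hasU s = true := by
        rcases P with - | ⟨y, - | ⟨z, P⟩⟩
        · simp at h
        · simp only [List.cons_append, List.nil_append, List.cons.injEq] at h
          rw [← h.2.2]; rfl
        · simp only [List.cons_append, List.cons.injEq] at h
          rw [← h.2.2, ← List.singleton_append, ← List.append_assoc]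
          exact hasU_append_cons_u _ _
      rw [h, mergeLastU, if_pos hs]
    · rw [mergeLastU]
      intro T T' s h h'
      exact hx ⟨T, T', s, h, h'⟩

theorem lambda0_append_singleton (w : List Letter) (x : Letter) :
    lambda0 (w ++ [x]) = lambda0Step (lambda0 w) x := by
  simp [lambda0]

theorem treeSequence_a (ts ts' : List PlaneTree) :
    lambda0Step (treeSequence ts ts') .a = treeSequence ts (ts' ++ [.τ]) := by
  simp [lambda0Step, treeSequence, replaceLastU_append _ _ (hasU_flatMap_tree_v _)]

theorem treeSequence_b (ts ts' : List PlaneTree) (t : PlaneTree) :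
    lambda0Step (treeSequence ts (ts' ++ [t])) .b =
      treeSequence (ts ++ [t]) (ts' ++ [.τ]) := by
  have := replaceFirstV_append (ts.flatMap (fun t => [Symb.u, .tree t]) ++ [.u, .tree t])
    (ts'.reverse.flatMap fun t => [.tree t, .v]) (by simp)
  simpa [lambda0Step, treeSequence] using this

theorem treeSequence_aBar (ts ts' : List PlaneTree) (t₁ t₂ : PlaneTree) :
    lambda0Step (treeSequence ts (ts' ++ [t₂, t₁])) .aBar =
      treeSequence ts (ts' ++ [.σ t₁ t₂]) := by
  have := mergeFirstV_append (ts.flatMap (fun t => [Symb.u, .tree t]) ++ [.u])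
    (.v :: ts'.reverse.flatMap fun t => [.tree t, .v]) t₁ t₂ (by simp)
  simpa [lambda0Step, treeSequence] using this

/-- The last `u` separates the two groups of trees, so its neighbours are the most recent tree of
each group. -/
theorem treeSequence_bBar (ts ts' : List PlaneTree) (t₁ t₂ : PlaneTree) :
    lambda0Step (treeSequence (ts ++ [t₁]) (ts' ++ [t₂])) .bBar =
      treeSequence ts (ts' ++ [.σ t₁ t₂]) := by
  have := mergeLastU_append (ts.flatMap (fun t => [Symb.u, .tree t]) ++ [.u])
    (.v :: ts'.reverse.flatMap fun t => [.tree t, .v]) t₁ t₂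
    (by simpa [hasU] using hasU_flatMap_tree_v ts'.reverse)
  simpa [lambda0Step, treeSequence] using this

/-! # Pairing of letters -/

/-- The positions of the letters `c` that are still waiting for their `d` once the first `n`
letters of `s` have been read, the last one first. -/
def stack (c d : Letter) (s : List Letter) : ℕ → List ℕ
  | 0 => []
  | n + 1 =>
    if s[n]? = some c then n :: stack c d s n
    else if s[n]? = some d then (stack c d s n).tail
    else stack c d s n

section stack

variable {c d : Letter} {s : List Letter}

theorem stack_open {n : ℕ} (h : s[n]? = some c) : stack c d s (n + 1) = n :: stack c d s n := by
  rw [stack, if_pos h]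

theorem stack_close (hcd : c ≠ d) {n : ℕ} (h : s[n]? = some d) :
    stack c d s (n + 1) = (stack c d s n).tail := by
  rw [stack, if_neg (by simpa [h] using hcd.symm), if_pos h]

theorem stack_other {n : ℕ} (h : s[n]? ≠ some c) (h' : s[n]? ≠ some d) :
    stack c d s (n + 1) = stack c d s n := by
  rw [stack, if_neg h, if_neg h']

theorem lt_of_mem_stack {n i : ℕ} (h : i ∈ stack c d s n) : i < n := by
  induction n with
  | zero => simp [stack] at h
  | succ n ih =>
    rw [stack] at h
    split_ifs at h
    · rcases List.mem_cons.mp h with rfl | h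
      · omega
      · have := ih h; omega
    · have := ih (List.mem_of_mem_tail h); omega
    · have := ih h; omega

theorem getElem?_of_mem_stack {n i : ℕ} (h : i ∈ stack c d s n) : s[i]? = some c := by
  induction n with
  | zero => simp [stack] at h
  | succ n ih =>
    rw [stack] at h
    split_ifs at h with h1
    · rcases List.mem_cons.mp h with rfl | h
      · exact h1
      · exact ih h
    · exact ih (List.mem_of_mem_tail h)
    · exact ih h

theorem stack_pairwise (n : ℕ) : (stack c d s n).Pairwise (· > ·) := by
  induction n with
  | zero => simp [stack]
  | succ n ih =>
    rw [stack]
    split_ifs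
    · exact List.pairwise_cons.mpr ⟨fun i hi => lt_of_mem_stack hi, ih⟩
    · exact ih.tail
    · exact ih

theorem isParenSystem_nil : IsParenSystem c d [] := by
  simp [IsParenSystem]

theorem IsParenSystem.append {p q : List Letter} (hp : IsParenSystem c d p)
    (hq : IsParenSystem c d q) : IsParenSystem c d (p ++ q) := by
  obtain ⟨hp1, hp2, hp3⟩ := hp
  obtain ⟨hq1, hq2, hq3⟩ := hq
  refine ⟨?_, by simp [hp2, hq2], ?_⟩
  · intro x hx
    rcases List.mem_append.mp hx with h | h
    exacts [hp1 x h, hq1 x h]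
  · intro r hr
    rw [List.mem_inits, List.prefix_iff_eq_take] at hr
    rw [hr, List.take_append, List.count_append, List.count_append]
    exact add_le_add (hp3 _ ((List.mem_inits _ _).mpr (List.take_prefix _ _)))
      (hq3 _ ((List.mem_inits _ _).mpr (List.take_prefix _ _)))

theorem IsParenSystem.wrap (hcd : c ≠ d) {p : List Letter} (hp : IsParenSystem c d p) :
    IsParenSystem c d (c :: (p ++ [d])) := by
  obtain ⟨hp1, hp2, hp3⟩ := hp
  refine ⟨?_, by simp [hp2, hcd, hcd.symm], ?_⟩
  · intro x hx
    simp only [List.mem_cons, List.mem_append, List.not_mem_nil, or_false] at hx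
    rcases hx with h | h | h
    exacts [.inl h, hp1 x h, .inr h]
  · intro r hr
    rw [List.mem_inits, List.prefix_cons_iff] at hr
    rcases hr with rfl | ⟨t, rfl, h⟩
    · simp
    · rw [List.prefix_concat_iff] at h
      rcases h with rfl | h
      · simp [hp2, hcd, hcd.symm]
      · have := hp3 t ((List.mem_inits _ _).mpr h)
        simp [hcd]
        omega

theorem between_succ_of_mem {i n : ℕ} {l : Letter} (hin : i < n) (h : s[n]? = some l)
    (hl : l = c ∨ l = d) : between c d s i (n + 1) = between c d s i n ++ [l] := by
  obtain ⟨hlt, rfl⟩ := List.getElem?_eq_some_iff.mp h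
  unfold between
  rw [List.take_succ_eq_append_getElem hlt, List.drop_append_of_le_length (by simp; omega),
    List.filter_append]
  simp [hl]

theorem between_succ_of_notMem {i n : ℕ} (hin : i < n) (h : s[n]? ≠ some c) (h' : s[n]? ≠ some d) :
    between c d s i (n + 1) = between c d s i n := by
  unfold between
  by_cases hlt : n < s.length
  · rw [List.take_succ_eq_append_getElem hlt, List.drop_append_of_le_length (by simp; omega),
      List.filter_append]
    simp only [List.getElem?_eq_getElem hlt, ne_eq, Option.some.injEq] at h h'
    simp [h, h']
  · rw [List.take_of_length_le (by omega), List.take_of_length_le (by omega)]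

theorem between_self_succ (i : ℕ) : between c d s i (i + 1) = [] := by
  unfold between
  rw [List.drop_eq_nil_of_le (by simp)]
  rfl

/-- Between two consecutive waiting letters, and after the last one, the word is a parenthesis
system. -/
theorem isChain_stack (hcd : c ≠ d) (n : ℕ) :
    (n :: stack c d s n).IsChain (fun j i => IsParenSystem c d (between c d s i j)) := by
  induction n with
  | zero => simp [stack]
  | succ n ih =>
    by_cases h : s[n]? = some c
    · rw [stack_open h, List.isChain_cons_cons]
      exact ⟨by rw [between_self_succ]; exact isParenSystem_nil, ih⟩
    · by_cases h' : s[n]? = some d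
      · rw [stack_close hcd h']
        rcases hst : stack c d s n with - | ⟨i, - | ⟨k, l⟩⟩
        · simp
        · simp
        · rw [hst, List.isChain_cons_cons, List.isChain_cons_cons] at ih
          obtain ⟨h1, h2, h3⟩ := ih
          have hi : i ∈ stack c d s n := by simp [hst]
          have hk : k ∈ stack c d s n := by simp [hst]
          have hki : k < i := by
            have := stack_pairwise (c := c) (d := d) (s := s) n
            rw [hst] at this
            exact (List.pairwise_cons.mp this).1 k (by simp)
          have hin := lt_of_mem_stack hi
          rw [List.tail_cons, List.isChain_cons_cons]
          refine ⟨?_, h3⟩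
          rw [between_succ_of_mem (hki.trans hin) h' (.inr rfl),
            between_split hki hin (getElem?_of_mem_stack hi) (.inl rfl), List.append_assoc,
            List.cons_append]
          -- The popped `c` at `i` and the new `d` enclose a parenthesis system, which follows the
          -- one between `k` and `i`.
          exact h2.append (h1.wrap hcd)
      · rw [stack_other h h']
        rcases hst : stack c d s n with - | ⟨i, l⟩
        · simp
        · rw [hst, List.isChain_cons_cons] at ih
          rw [List.isChain_cons_cons, between_succ_of_notMem (lt_of_mem_stack
            (c := c) (d := d) (s := s) (by simp [hst])) h h']
          exact ih

theorem paired_of_stack_eq_cons (hcd : c ≠ d) {n i : ℕ} {l : List ℕ} (hst : stack c d s n = i :: l)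
    (h : s[n]? = some d) : Paired c d s i n := by
  have hi : i ∈ stack c d s n := by simp [hst]
  have := isChain_stack (s := s) hcd n
  rw [hst, List.isChain_cons_cons] at this
  exact ⟨lt_of_mem_stack hi, getElem?_of_mem_stack hi, h, this.1⟩

/-- Every `d` is preceded by enough letters `c`. -/
def Balanced (c d : Letter) (s : List Letter) : Prop :=
  ∀ n, (s.take n).count d ≤ (s.take n).count c

/-- Balance ensures that no `d` meets an empty stack, on which `tail` would do nothing and the count
would fail. -/
theorem length_stack_add_count (hcd : c ≠ d) (hs : Balanced c d s) (n : ℕ) :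
    (stack c d s n).length + (s.take n).count d = (s.take n).count c := by
  induction n with
  | zero => simp [stack]
  | succ n ih =>
    rcases lt_or_ge n s.length with hlt | hlt
    · have hle := hs (n + 1)
      rw [List.take_succ_eq_append_getElem hlt] at hle ⊢
      have hg := List.getElem?_eq_getElem hlt
      by_cases h : s[n] = c
      · rw [stack_open (by rw [hg, h])]
        simp [h, hcd]
        omega
      · by_cases h' : s[n] = d
        · rw [stack_close hcd (by rw [hg, h'])]
          simp [h', hcd.symm] at hle ⊢
          omega
        · rw [stack_other (by simpa [hg] using h) (by simpa [hg] using h')]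
          simp only [List.count_append, List.count_singleton]
          simp [h, h', ih]
    · rw [stack_other (by simp [hlt]) (by simp [hlt]), List.take_of_length_le (by omega)]
      rw [List.take_of_length_le hlt] at ih
      exact ih

theorem exists_stack_eq_cons (hcd : c ≠ d) (hs : Balanced c d s) {n : ℕ} (h : s[n]? = some d) :
    ∃ i l, stack c d s n = i :: l := by
  rcases hst : stack c d s n with - | ⟨i, l⟩
  · have h1 := length_stack_add_count hcd hs n
    have h2 := hs (n + 1)
    obtain ⟨hlt, h⟩ := List.getElem?_eq_some_iff.mp h
    rw [List.take_succ_eq_append_getElem hlt] at h2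
    simp [h, hcd.symm] at h2
    simp [hst] at h1
    omega
  · exact ⟨i, l, rfl⟩

/-- Each `d` pops precisely the letter it is paired with, and it has only one partner; what stays on
the stack has had no partner so far. -/
theorem mem_stack (hcd : c ≠ d) (hs : Balanced c d s) {n i : ℕ} :
    i ∈ stack c d s n ↔ i < n ∧ s[i]? = some c ∧ ∀ j < n, ¬ Paired c d s i j := by
  induction n with
  | zero => simp [stack]
  | succ n ih =>
    by_cases h : s[n]? = some c
    · rw [stack_open h, List.mem_cons, ih]
      constructor
      · rintro (rfl | ⟨h1, h2, h3⟩)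
        · exact ⟨by omega, h, fun j hj hp => by have := hp.1; omega⟩
        · refine ⟨by omega, h2, fun j hj hp => ?_⟩
          rcases Nat.lt_succ_iff_lt_or_eq.mp hj with hj | rfl
          · exact h3 j hj hp
          · exact hcd (Option.some_injective _ (h.symm.trans hp.2.2.1))
      · rintro ⟨h1, h2, h3⟩
        rcases Nat.lt_succ_iff_lt_or_eq.mp h1 with h1 | rfl
        · exact .inr ⟨h1, h2, fun j hj => h3 j (by omega)⟩
        · exact .inl rfl
    · by_cases h' : s[n]? = some d
      · obtain ⟨k, l, hst⟩ := exists_stack_eq_cons hcd hs h'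
        have hk := paired_of_stack_eq_cons hcd hst h'
        have hpw := stack_pairwise (c := c) (d := d) (s := s) n
        rw [stack_close hcd h']
        rw [hst] at ih hpw ⊢
        rw [List.tail_cons]
        have hkl : k ∉ l := fun hk => lt_irrefl _ ((List.pairwise_cons.mp hpw).1 k hk)
        constructor
        · intro hi
          obtain ⟨h1, h2, h3⟩ := ih.mp (List.mem_cons_of_mem _ hi)
          refine ⟨by omega, h2, fun j hj hp => ?_⟩
          rcases Nat.lt_succ_iff_lt_or_eq.mp hj with hj | rfl
          · exact h3 j hj hp
          · exact hkl (hp.unique_left hcd hk ▸ hi)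
        · rintro ⟨h1, h2, h3⟩
          have hin : i ≠ n := by rintro rfl; exact h h2
          rcases List.mem_cons.mp (ih.mpr ⟨by omega, h2, fun j hj => h3 j (by omega)⟩) with e | hi
          · exact absurd (e ▸ hk) (h3 n (by omega))
          · exact hi
      · rw [stack_other h h', ih]
        constructor
        · rintro ⟨h1, h2, h3⟩
          refine ⟨by omega, h2, fun j hj hp => ?_⟩
          rcases Nat.lt_succ_iff_lt_or_eq.mp hj with hj | rfl
          · exact h3 j hj hp
          · exact h' hp.2.2.1
        · rintro ⟨h1, h2, h3⟩
          have hin : i ≠ n := by rintro rfl; exact h h2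
          exact ⟨by omega, h2, fun j hj => h3 j (by omega)⟩

end stack

/-! # The words `w` and `w⁺` -/

theorem getElem?_plus_of_lt {w : List Letter} {n : ℕ} (h : n < w.length) :
    (plus w)[n]? = w[n]? := by
  rw [plus, List.getElem?_append_left h]

theorem getElem?_plus_of_le {w : List Letter} {n : ℕ} (h : w.length ≤ n)
    (h' : n < (plus w).length) : (plus w)[n]? = some .aBar := by
  rw [plus, List.getElem?_append_right h, List.getElem?_replicate, if_pos]
  simp [plus] at h'
  omega

theorem length_le_length_plus (w : List Letter) : w.length ≤ (plus w).length := by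
  simp [plus]

theorem between_plus (c d : Letter) {w : List Letter} {i j : ℕ} (hj : j ≤ w.length) :
    between c d (plus w) i j = between c d w i j := by
  unfold between
  rw [plus, List.take_append_of_le_length hj]

theorem paired_plus_iff (c d : Letter) {w : List Letter} {i j : ℕ} (hj : j < w.length) :
    Paired c d (plus w) i j ↔ Paired c d w i j := by
  unfold Paired
  rw [between_plus c d hj.le, getElem?_plus_of_lt hj]
  constructor
  · rintro ⟨h1, h2, h3⟩
    exact ⟨h1, by rwa [getElem?_plus_of_lt (h1.trans hj)] at h2, h3⟩
  · rintro ⟨h1, h2, h3⟩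
    exact ⟨h1, by rwa [getElem?_plus_of_lt (h1.trans hj)], h3⟩

theorem IsPrefixShuffle.balanced_a {w : List Letter} (hw : IsPrefixShuffle w) :
    Balanced .a .aBar (plus w) := by
  intro n
  rcases le_total n w.length with h | h
  · rw [plus, List.take_append_of_le_length h]
    exact (hw _ ((List.mem_inits _ _).mpr (List.take_prefix _ _))).1
  · have hw' := (hw w ((List.mem_inits _ _).mpr List.prefix_rfl)).1
    rw [plus, List.take_append, List.take_of_length_le h]
    simp [List.take_replicate, List.count_replicate]
    omega

theorem IsPrefixShuffle.balanced_b {w : List Letter} (hw : IsPrefixShuffle w) :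
    Balanced .b .bBar (plus w) := by
  intro n
  rcases le_total n w.length with h | h
  · rw [plus, List.take_append_of_le_length h]
    exact (hw _ ((List.mem_inits _ _).mpr (List.take_prefix _ _))).2
  · have hw' := (hw w ((List.mem_inits _ _).mpr List.prefix_rfl)).2
    rw [plus, List.take_append, List.take_of_length_le h]
    simp [List.take_replicate, List.count_replicate]
    omega

/-- The word `w⁺` has as many `ā` as `a`, so every edge of the spanning tree, active or not, gets
its head. -/
theorem IsPrefixShuffle.stack_length_plus {w : List Letter} (hw : IsPrefixShuffle w) :
    stack .a .aBar (plus w) (plus w).length = [] := by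
  have h := length_stack_add_count (by decide) hw.balanced_a (plus w).length
  have hw' := (hw w ((List.mem_inits _ _).mpr List.prefix_rfl)).1
  rw [List.take_length] at h
  have h1 : (plus w).count .aBar = (plus w).count .a := by
    simp [plus, List.count_append, List.count_replicate]
    omega
  rw [← List.length_eq_zero_iff]
  omega

/-- A pairing that ends inside `w` is the same in `w` and in `w⁺`, so the stack of `w⁺` at time
`w.length` describes `w` alone. -/
theorem nonPaired_iff_mem_stack {c d : Letter} (hcd : c ≠ d) {w : List Letter}
    (hs : Balanced c d (plus w)) {i : ℕ} :
    NonPaired c d w i ↔ i ∈ stack c d (plus w) w.length := by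
  rw [mem_stack hcd hs, NonPaired]
  constructor
  · rintro ⟨h1, h2⟩
    have hi := (List.getElem?_eq_some_iff.mp h1).1
    refine ⟨hi, by rwa [getElem?_plus_of_lt hi], fun j hj hp => ?_⟩
    exact h2 j (List.mem_range.mpr hj) ((paired_plus_iff c d hj).mp hp)
  · rintro ⟨h1, h2, h3⟩
    refine ⟨by rwa [getElem?_plus_of_lt h1] at h2, fun j hj hp => ?_⟩
    exact h3 j (List.mem_range.mp hj) ((paired_plus_iff c d (List.mem_range.mp hj)).mpr hp)

/-! # Cycles of first returns -/

section firstReturn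

variable {H L : Type} [Finite H] [DecidableEq L]

theorem firstReturn_eq_pow (ρ : Equiv.Perm H) (f : H → L) (x : H) {k : ℕ} (hk : 1 ≤ k)
    (h : f ((ρ ^ k) x) = f x) (hlt : ∀ j, 1 ≤ j → j < k → f ((ρ ^ j) x) ≠ f x) :
    firstReturn ρ f x = (ρ ^ k) x := by
  have : Nat.find (exists_return_label ρ f x) = k :=
    (Nat.find_eq_iff _).mpr ⟨⟨hk, h⟩, fun j hj hj' => hlt j hj'.1 hj hj'.2⟩
  change firstReturnFun ρ f x = _
  rw [firstReturnFun, this]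

theorem firstReturn_eq_of_label_eq (ρ : Equiv.Perm H) (f : H → L) (x : H) (h : f (ρ x) = f x) :
    firstReturn ρ f x = ρ x :=
  firstReturn_eq_pow ρ f x (k := 1) le_rfl (by simpa using h) (by omega)

end firstReturn

theorem pow_eq_getElem_of_isChain {H : Type} {ρ : Equiv.Perm H} {x : H} {l : List H}
    (h : (x :: l).IsChain (fun a b => ρ a = b)) (j : ℕ) (hj : j < l.length) :
    (ρ ^ (j + 1)) x = l[j] := by
  induction j generalizing x l with
  | zero =>
    cases l with
    | nil => simp at hj
    | cons y l => simpa using (List.isChain_cons_cons.mp h).1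
  | succ j ih =>
    cases l with
    | nil => simp at hj
    | cons y l =>
      obtain ⟨h1, h2⟩ := List.isChain_cons_cons.mp h
      rw [pow_succ, Equiv.Perm.mul_apply, h1, ih h2 (by simpa using hj)]
      simp

/-- Each head `h` is preceded around its vertex by the tails of the list `kids h`, and by
no other tail after the previous head. -/
structure IsCorners {H : Type} (next : Equiv.Perm H) (isHead : H → Bool) (kids : H → List H) :
    Prop where
  chain : ∀ h, isHead h = true → (kids h ++ [h]).IsChain (fun x y => next x = y)
  tail : ∀ h, isHead h = true → ∀ x ∈ kids h, isHead x = false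
  exists_mem : ∀ x, isHead x = false → ∃ h, isHead h = true ∧ x ∈ kids h

/-! ## Deletion -/

section delete

variable {H : Type} {p : H → Bool}

/-- The elements of `l` which are not deleted. -/
def keep (p : H → Bool) (l : List H) : List {x : H // p x = false} :=
  l.filterMap fun x => if h : p x = false then some ⟨x, h⟩ else none

theorem keep_cons_of_eq_false {x : H} (hx : p x = false) (l : List H) :
    keep p (x :: l) = ⟨x, hx⟩ :: keep p l := by
  simp [keep, hx]

theorem keep_cons_of_eq_true {x : H} (hx : p x = true) (l : List H) :
    keep p (x :: l) = keep p l := by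
  simp [keep, hx]

theorem keep_append (l l' : List H) : keep p (l ++ l') = keep p l ++ keep p l' := by
  simp [keep]

theorem mem_keep {l : List H} {x : {x : H // p x = false}} : x ∈ keep p l ↔ x.1 ∈ l := by
  obtain ⟨x, hx⟩ := x
  simp [keep, hx]

variable [Finite H]

/-- The cyclic order on the elements which are not deleted. -/
noncomputable def deleteNext (ρ : Equiv.Perm H) (p : H → Bool) :
    Equiv.Perm {x : H // p x = false} :=
  (firstReturn ρ p).subtypePerm (fun x => by rw [label_firstReturn ρ p x])

theorem deleteNext_eq {ρ : Equiv.Perm H} {x z : {x : H // p x = false}} (k : ℕ)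
    (hk : ∀ j, 1 ≤ j → j ≤ k → p ((ρ ^ j) x.1) = true) (hz : (ρ ^ (k + 1)) x.1 = z.1) :
    deleteNext ρ p x = z := by
  refine Subtype.ext ?_
  change firstReturn ρ p x.1 = z.1
  rw [firstReturn_eq_pow ρ p x.1 (k := k + 1) (by omega) (by rw [hz, x.2]; exact z.2), hz]
  intro j h1 h2
  rw [hk j h1 (by omega), x.2]
  simp

/-- Here `k` counts the deleted elements already skipped after `x`; carrying it lets the induction
cross a whole run of deletions. The run stops at the latest at `y`, which is kept. -/
theorem deleteNext_eq_of_isChain {ρ : Equiv.Perm H} {x : {x : H // p x = false}} {y : H}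
    (hy : p y = false) (l : List H) (k : ℕ) (hk : ∀ j, 1 ≤ j → j ≤ k → p ((ρ ^ j) x.1) = true)
    (h : ((ρ ^ k) x.1 :: (l ++ [y])).IsChain (fun x y => ρ x = y)) :
    ∀ z ∈ (keep p (l ++ [y])).head?, deleteNext ρ p x = z := by
  induction l generalizing k with
  | nil =>
    intro z hz
    rw [List.nil_append, keep_cons_of_eq_false hy] at hz
    cases hz
    apply deleteNext_eq k hk
    rw [pow_succ', Equiv.Perm.mul_apply]
    exact (List.isChain_cons_cons.mp h).1
  | cons u l ih =>
    obtain ⟨h1, h2⟩ := List.isChain_cons_cons.mp h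
    rw [← Equiv.Perm.mul_apply, ← pow_succ'] at h1
    intro z hz
    cases hu : p u with
    | false =>
      rw [List.cons_append, keep_cons_of_eq_false hu] at hz
      cases hz
      exact deleteNext_eq k hk h1
    | true =>
      rw [List.cons_append, keep_cons_of_eq_true hu] at hz
      refine ih (k + 1) ?_ (by rw [h1]; exact h2) z hz
      intro j hj hj'
      rcases Nat.le_succ_iff.mp hj' with hj' | rfl
      · exact hk j hj hj'
      · rw [h1, hu]

theorem isChain_keep {ρ : Equiv.Perm H} {y : H} (hy : p y = false) (l : List H)
    (h : (l ++ [y]).IsChain (fun x y => ρ x = y)) :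
    (keep p (l ++ [y])).IsChain (fun x y => deleteNext ρ p x = y) := by
  induction l with
  | nil =>
    rw [List.nil_append, keep_cons_of_eq_false hy]
    exact List.isChain_singleton _
  | cons x l ih =>
    cases hx : p x with
    | false =>
      rw [List.cons_append, keep_cons_of_eq_false hx]
      refine List.isChain_cons.mpr ⟨?_, ih (List.isChain_cons.mp h).2⟩
      exact deleteNext_eq_of_isChain hy l 0 (by omega) h
    | true =>
      rw [List.cons_append, keep_cons_of_eq_true hx]
      exact ih (List.isChain_cons.mp h).2

/-- Only tails are deleted, so every head survives and its list is merely shortened. -/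
theorem IsCorners.delete {ρ : Equiv.Perm H} {isHead : H → Bool} {kids : H → List H}
    (hM : IsCorners ρ isHead kids) (hp : ∀ x, p x = true → isHead x = false) :
    IsCorners (deleteNext ρ p) (fun x => isHead x.1) (fun h => keep p (kids h.1)) where
  chain := by
    rintro ⟨h, hph⟩ hh
    have := isChain_keep hph _ (hM.chain h hh)
    rwa [keep_append, keep_cons_of_eq_false hph] at this
  tail h hh x hx := hM.tail h.1 hh x.1 (mem_keep.mp hx)
  exists_mem x hx := by
    obtain ⟨h, hh, hxh⟩ := hM.exists_mem x.1 hx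
    have hph : p h = false := by
      cases e : p h with
      | false => rfl
      | true => rw [hp h e] at hh; exact absurd hh (by simp)
    exact ⟨⟨h, hph⟩, hh, mem_keep.mpr hxh⟩

end delete

namespace OrientedMap

theorem delete_mate_of_eq_false {M : OrientedMap} {p : M.HalfEdge → Bool}
    {x : {x : M.HalfEdge // p x = false}} (h : p (M.mate x.1) = false) :
    (M.delete p).mate x = (⟨M.mate x.1, h⟩ : {x : M.HalfEdge // p x = false}) :=
  dif_pos h

theorem delete_mate_of_eq_true {M : OrientedMap} {p : M.HalfEdge → Bool}
    {x : {x : M.HalfEdge // p x = false}} (h : p (M.mate x.1) = true) :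
    (M.delete p).mate x = x :=
  dif_neg (by simp [h])

/-! ## Explosion -/

section explode

variable {M : OrientedMap} {kids : M.HalfEdge → List M.HalfEdge}

theorem firstHead_eq_pow {x : M.HalfEdge} {k : ℕ} (hk : M.isHead ((M.next ^ k) x) = true)
    (hlt : ∀ j < k, M.isHead ((M.next ^ j) x) = false) : M.firstHead x = (M.next ^ k) x := by
  have : Nat.find (M.exists_head x) = k := by
    refine (Nat.find_eq_iff _).mpr ⟨.inl hk, fun j hj => ?_⟩
    rintro (h | ⟨h1, h2⟩)
    · rw [hlt j hj] at h; simp at h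
    -- A return to `x` after `j` steps would bring the head met at step `k` already at step `k - j`,
    -- where there is none.
    · have : (M.next ^ k) x = (M.next ^ (k - j)) x := by
        conv_lhs => rw [← Nat.sub_add_cancel hj.le, pow_add, Equiv.Perm.mul_apply, h2]
      rw [this, hlt _ (by omega)] at hk
      simp at hk
  rw [firstHead, this]

theorem firstHead_of_isHead {x : M.HalfEdge} (hx : M.isHead x = true) : M.firstHead x = x := by
  simpa using firstHead_eq_pow (M := M) (x := x) (k := 0) (by simpa using hx) (by simp)

/-- Starting from a tail of the list, the chain meets only tails until it reaches `h`. The classes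
used by the explosion are thus the lists `kids h ++ [h]`. -/
theorem _root_.PrefixShuffle.IsCorners.firstHead_eq (hM : IsCorners M.next M.isHead kids) {h : M.HalfEdge} (hh : M.isHead h = true)
    {x : M.HalfEdge} (hx : x ∈ kids h ++ [h]) : M.firstHead x = h := by
  rcases List.mem_append.mp hx with hx | hx
  · obtain ⟨l, l', e⟩ := List.append_of_mem hx
    have hc := hM.chain h hh
    have ht := hM.tail h hh
    rw [e, List.append_assoc, List.cons_append] at hc
    have hpow := pow_eq_getElem_of_isChain hc.right_of_append
    have hk : (M.next ^ (l'.length + 1)) x = h := by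
      rw [hpow l'.length (by simp)]; simp
    rw [firstHead_eq_pow (k := l'.length + 1) (by rw [hk, hh]), hk]
    intro j hj
    rcases j with - | j
    · simpa using ht x hx
    · rw [hpow j (by simp; omega), List.getElem_append_left (by omega)]
      apply ht
      rw [e]
      simp
  · rw [List.mem_singleton.mp hx, firstHead_of_isHead hh]

theorem _root_.PrefixShuffle.IsCorners.mem_of_firstHead_eq (hM : IsCorners M.next M.isHead kids) {x h : M.HalfEdge}
    (hx : M.firstHead x = h) : M.isHead h = true ∧ x ∈ kids h ++ [h] := by
  cases e : M.isHead x with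
  | true => rw [firstHead_of_isHead e] at hx; subst hx; simp [e]
  | false =>
    obtain ⟨h', hh', hxh⟩ := hM.exists_mem x e
    have := hM.firstHead_eq hh' (List.mem_append_left _ hxh)
    rw [hx] at this
    subst this
    exact ⟨hh', List.mem_append_left _ hxh⟩

/-- The cyclic order around the vertices of the exploded map. -/
noncomputable def explodeNext (M : OrientedMap) : Equiv.Perm M.HalfEdge :=
  firstReturn M.next M.firstHead

theorem firstHead_explodeNext {M : OrientedMap} (x : M.HalfEdge) :
    M.firstHead (M.explodeNext x) = M.firstHead x :=
  label_firstReturn _ _ _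

theorem explodeNext_eq {x : M.HalfEdge} (h : M.firstHead (M.next x) = M.firstHead x) :
    M.explodeNext x = M.next x :=
  firstReturn_eq_of_label_eq _ _ _ h

/-- The vertices of the exploded map. -/
theorem _root_.PrefixShuffle.IsCorners.isChain_explode (hM : IsCorners M.next M.isHead kids) {h : M.HalfEdge}
    (hh : M.isHead h = true) :
    (h :: (kids h ++ [h])).IsChain (fun x y => M.explodeNext x = y) := by
  have hc : (kids h ++ [h]).IsChain (fun x y => M.explodeNext x = y) := by
    rw [List.isChain_iff_getElem]
    intro i hi
    have := List.isChain_iff_getElem.mp (hM.chain h hh) i hi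
    rw [explodeNext_eq, this]
    rw [this, hM.firstHead_eq hh (List.getElem_mem _), hM.firstHead_eq hh (List.getElem_mem _)]
  -- The successor of `h` keeps its label, so it lies in the list. At a positive index it would also
  -- be the successor of a tail, against injectivity.
  refine List.isChain_cons.mpr ⟨?_, hc⟩
  intro y hy
  have hlabel : M.firstHead (M.explodeNext h) = h := by
    rw [firstHead_explodeNext, firstHead_of_isHead hh]
  obtain ⟨-, hmem⟩ := hM.mem_of_firstHead_eq hlabel
  obtain ⟨i, hi, e⟩ := List.getElem_of_mem hmem
  rcases i with - | i
  · rw [← e]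
    rw [List.head?_eq_getElem?, List.getElem?_eq_getElem hi] at hy
    exact Option.some_injective _ hy
  · exfalso
    have h1 := List.isChain_iff_getElem.mp hc i hi
    have h2 := M.explodeNext.injective (e.symm.trans h1.symm).symm
    have hi' : i < (kids h).length := by simp at hi; omega
    rw [List.getElem_append_left hi'] at h2
    have := hM.tail h hh _ (List.getElem_mem hi')
    rw [h2, hh] at this
    simp at this

theorem _root_.PrefixShuffle.IsCorners.explode_pow (hM : IsCorners M.next M.isHead kids) {h : M.HalfEdge} (hh : M.isHead h = true)
    {i : ℕ} (hi : i < (kids h).length) : (M.explodeNext ^ (i + 1)) h = (kids h)[i] := by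
  have := pow_eq_getElem_of_isChain (hM.isChain_explode hh) i (by simp; omega)
  rwa [List.getElem_append_left hi] at this

theorem _root_.PrefixShuffle.IsCorners.explode_pow_length (hM : IsCorners M.next M.isHead kids) {h : M.HalfEdge}
    (hh : M.isHead h = true) : (M.explodeNext ^ ((kids h).length + 1)) h = h := by
  have := pow_eq_getElem_of_isChain (hM.isChain_explode hh) (kids h).length (by simp)
  simpa using this

/-- A shorter period would make `h` one of its own `kids`, which are tails. -/
theorem _root_.PrefixShuffle.IsCorners.minimalPeriod_explode (hM : IsCorners M.next M.isHead kids) {h : M.HalfEdge}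
    (hh : M.isHead h = true) :
    Function.minimalPeriod M.explodeNext h = (kids h).length + 1 := by
  have hper : Function.IsPeriodicPt M.explodeNext ((kids h).length + 1) h := by
    change M.explodeNext^[_] h = h
    rw [Equiv.Perm.iterate_eq_pow]
    exact hM.explode_pow_length hh
  refine le_antisymm (hper.minimalPeriod_le (by omega)) ?_
  by_contra hlt
  have hpos := hper.minimalPeriod_pos (by omega)
  obtain ⟨m, hm⟩ := Nat.exists_eq_succ_of_ne_zero hpos.ne'
  have hm' : m < (kids h).length := by omega
  have h1 : (M.explodeNext ^ (m + 1)) h = h := by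
    rw [← Equiv.Perm.iterate_eq_pow, ← Nat.succ_eq_add_one, ← hm]
    exact Function.iterate_minimalPeriod
  rw [hM.explode_pow hh hm'] at h1
  have h2 := hM.tail h hh _ (List.getElem_mem hm')
  rw [h1, hh] at h2
  simp at h2

/-- A list of tails carries the trees of a list. -/
def Carries (M : OrientedMap) (l : List M.HalfEdge) (ts : List PlaneTree) : Prop :=
  List.Forall₂ (fun x t => M.mate x ≠ x ∧ M.HasShape (M.mate x) t) l ts

theorem _root_.PrefixShuffle.IsCorners.hasShape_explode (hM : IsCorners M.next M.isHead kids) {h : M.HalfEdge}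
    (hh : M.isHead h = true) {ts : List PlaneTree} (hts : M.explode.Carries (kids h) ts) :
    M.explode.HasShape h (.node ts) := by
  have hlen : (kids h).length = ts.length := hts.length_eq
  have hget : ∀ i (hi : i < (kids h).length) (hi' : i < ts.length),
      M.explode.mate (kids h)[i] ≠ (kids h)[i] ∧
        M.explode.HasShape (M.explode.mate (kids h)[i]) ts[i] :=
    fun i hi hi' => (List.forall₂_iff_get.mp hts).2 i hi hi'
  have edges : ∀ i < ts.length, M.explode.mate ((M.explodeNext ^ (i + 1)) h) ≠
      (M.explodeNext ^ (i + 1)) h := by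
    intro i hi
    rw [hM.explode_pow hh (by omega)]
    exact (hget i (by omega) hi).1
  have subtrees : ∀ (i : ℕ) (hi : i < ts.length),
      M.explode.HasShape (M.explode.mate ((M.explodeNext ^ (i + 1)) h)) ts[i] := by
    intro i hi
    rw [hM.explode_pow hh (by omega)]
    exact (hget i (by omega) hi).2
  exact HasShape.node (M := M.explode) h ts ((hM.minimalPeriod_explode hh).trans (by rw [hlen])) edges subtrees

end explode

/-! ### One head per vertex. -/

/-- Each vertex has exactly one head. -/
structure UniqueHeads (M : OrientedMap) : Prop where
  exists_head : ∀ x, ∃ h, M.isHead h = true ∧ M.next.SameCycle h x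
  eq : ∀ h h', M.isHead h = true → M.isHead h' = true → M.next.SameCycle h h' → h = h'

theorem firstHead_explodeNext_pow {M : OrientedMap} (k : ℕ) (x : M.HalfEdge) :
    M.firstHead ((M.explodeNext ^ k) x) = M.firstHead x := by
  induction k with
  | zero => rfl
  | succ k ih => rw [pow_succ', Equiv.Perm.mul_apply, firstHead_explodeNext, ih]

/-- A head is its own `firstHead`, and `firstHead` is constant on the cycles of the exploded map, so
it names the vertices. -/
theorem _root_.PrefixShuffle.IsCorners.uniqueHeads_explode {M : OrientedMap}
    {kids : M.HalfEdge → List M.HalfEdge} (hM : IsCorners M.next M.isHead kids) :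
    M.explode.UniqueHeads := by
  have exists_head : ∀ x : M.HalfEdge, ∃ h, M.isHead h = true ∧ M.explodeNext.SameCycle h x := by
    intro x
    obtain ⟨hh, hmem⟩ := hM.mem_of_firstHead_eq (x := x) rfl
    refine ⟨M.firstHead x, hh, ?_⟩
    obtain ⟨i, hi, e⟩ := List.getElem_of_mem hmem
    have := pow_eq_getElem_of_isChain (hM.isChain_explode hh) i hi
    rw [e] at this
    exact ⟨(i + 1 : ℕ), by rw [zpow_natCast]; exact this⟩
  have eq : ∀ h h' : M.HalfEdge, M.isHead h = true → M.isHead h' = true →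
      M.explodeNext.SameCycle h h' → h = h' := by
    intro h h' hh hh' hs
    obtain ⟨k, hk⟩ := hs.exists_nat_pow_eq
    have h1 := firstHead_explodeNext_pow k h
    rwa [hk, firstHead_of_isHead hh, firstHead_of_isHead hh', eq_comm] at h1
  exact ⟨exists_head, eq⟩

variable {M : OrientedMap}

/-! ## Components and trees -/

theorem component_next_pow_val (r : M.HalfEdge) (k : ℕ) (x : (M.component r).HalfEdge) :
    (((M.component r).next ^ k) x).1 = (M.next ^ k) x.1 := by
  induction k generalizing x with
  | zero => rfl
  | succ k ih =>
    rw [pow_succ, Equiv.Perm.mul_apply, ih, pow_succ, Equiv.Perm.mul_apply]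
    rfl

theorem HasShape.component {r y : M.HalfEdge} {t : PlaneTree} (h : M.HasShape y t)
    (hy : M.Joined r y) : (M.component r).HasShape ⟨y, hy⟩ t := by
  induction h with
  | node y ts degree edges _ ih =>
    have hpow : ∀ k, ((M.component r).next ^ k) ⟨y, hy⟩ =
        ⟨(M.next ^ k) y, by
          rw [← component_next_pow_val r k ⟨y, hy⟩]; exact (((M.component r).next ^ k) _).2⟩ :=
      fun k => Subtype.ext (component_next_pow_val r k _)
    refine .node _ ts ?_ ?_ ?_
    · rw [← degree]
      refine Function.minimalPeriod_eq_minimalPeriod_iff.mpr fun n => ?_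
      change (M.component r).next^[n] _ = _ ↔ M.next^[n] y = y
      rw [Equiv.Perm.iterate_eq_pow, Equiv.Perm.iterate_eq_pow, hpow]
      exact Subtype.ext_iff
    · intro i hi e
      rw [hpow] at e
      exact edges i hi (congrArg Subtype.val e)
    · intro i hi
      rw [hpow]
      exact ih i hi _

theorem component_joined {r x y : M.HalfEdge} (h : M.Joined x y) (hx : M.Joined r x)
    (hy : M.Joined r y) : (M.component r).Joined ⟨x, hx⟩ ⟨y, hy⟩ := by
  unfold Joined at h
  induction h with
  | rel x y h =>
    refine .rel _ _ (h.imp ?_ ?_)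
    · intro e; exact Subtype.ext e
    · intro e; exact Subtype.ext e
  | refl x => exact .refl _
  | symm x y _ ih => exact .symm _ _ (ih hy hx)
  | trans x y z hxy _ ih ih' =>
    exact .trans _ _ _ (ih hx (.trans _ _ _ hx hxy)) (ih' (.trans _ _ _ hx hxy) hy)

theorem UniqueHeads.component (hM : M.UniqueHeads) (r : M.HalfEdge) :
    (M.component r).UniqueHeads where
  exists_head x := by
    obtain ⟨h, hh, hs⟩ := hM.exists_head x.1
    obtain ⟨k, hk⟩ := hs.symm.exists_nat_pow_eq
    have hval := component_next_pow_val r k x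
    rw [hk] at hval
    refine ⟨((M.component r).next ^ k) x, ?_, ?_⟩
    · change M.isHead _ = true
      rw [hval, hh]
    · exact Equiv.Perm.SameCycle.symm ⟨(k : ℤ), by rw [zpow_natCast]⟩
  eq h h' hh hh' hs := by
    obtain ⟨k, hk⟩ := hs.exists_nat_pow_eq
    refine Subtype.ext (hM.eq _ _ hh hh' ⟨(k : ℤ), ?_⟩)
    rw [zpow_natCast, ← component_next_pow_val, hk]

theorem UniqueHeads.numVertices_eq (hM : M.UniqueHeads) :
    M.numVertices = Nat.card {x : M.HalfEdge // M.isHead x = true} := by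
  symm
  refine Nat.card_eq_of_bijective
    (fun x => (Quotient.mk (Equiv.Perm.SameCycle.setoid M.next) x.1)) ⟨?_, ?_⟩
  · intro x y h
    exact Subtype.ext (hM.eq _ _ x.2 y.2 (Quotient.exact h))
  · intro q
    induction q using Quotient.inductionOn with
    | h x =>
      obtain ⟨h, hh, hs⟩ := hM.exists_head x
      exact ⟨⟨h, hh⟩, Quotient.sound hs⟩

/-- Each head other than `r` stands for one edge. With one head per vertex this becomes `V = E + 1`.
-/
theorem card_heads_eq_numEdges_add_one {r : M.HalfEdge} (hr : M.isHead r = true)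
    (hroot : ∀ x, M.mate x = x ↔ x = r) :
    Nat.card {x : M.HalfEdge // M.isHead x = true} = M.numEdges + 1 := by
  have h := Set.ncard_sdiff_singleton_add_one (s := {x | M.isHead x = true}) (a := r) hr
  have e : {x | M.isHead x = true} \ {r} = {x | M.isHead x = true ∧ M.mate x ≠ x} := by
    ext x
    simp [hroot]
  rw [e] at h
  exact h.symm

/-! ### Face borders and the recognition of trees. -/

/-- Following the border of a face from `x` one reaches `y`. -/
def FaceReach (M : OrientedMap) (x y : M.HalfEdge) : Prop :=
  ∃ k : ℕ, ((M.next * M.mate) ^ k) x = y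

theorem FaceReach.trans {x y z : M.HalfEdge} (h : M.FaceReach x y) (h' : M.FaceReach y z) :
    M.FaceReach x z := by
  obtain ⟨k, rfl⟩ := h
  obtain ⟨m, rfl⟩ := h'
  exact ⟨m + k, by rw [pow_add, Equiv.Perm.mul_apply]⟩

theorem faceReach_refl (x : M.HalfEdge) : M.FaceReach x x := ⟨0, rfl⟩

theorem faceReach_next_mate (x : M.HalfEdge) : M.FaceReach x (M.next (M.mate x)) :=
  ⟨1, by simp⟩

/-- The tour of a planted plane tree visits a set of half-edges which is closed under `next` and,
the root excepted, under `mate`. -/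
theorem HasShape.tour {r : M.HalfEdge} {t : PlaneTree} (h : M.HasShape r t) :
    ∃ S : Set M.HalfEdge, r ∈ S ∧ (∀ y ∈ S, M.next y ∈ S) ∧
      (∀ y ∈ S, y = r ∨ (M.mate y ≠ y ∧ M.mate y ∈ S)) ∧
      ∀ y ∈ S, M.FaceReach (M.next r) y ∧ M.FaceReach y r := by
  induction h with
  | node r ts degree edges _ ih =>
    -- For `i < ts.length`, `x i` carries the edge to the son `i`; since the degree is `ts.length +
    -- 1`, `x ts.length` is `r` again.
    set x : ℕ → M.HalfEdge := fun i => (M.next ^ (i + 1)) r with hx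
    have hxs : ∀ i, M.next (x i) = x (i + 1) := fun i => by
      simp only [hx]
      rw [pow_succ' _ (i + 1), Equiv.Perm.mul_apply]
    have hx0 : x 0 = M.next r := by simp [hx]
    have hxl : x ts.length = r := by
      simp only [hx]
      rw [← degree, ← Equiv.Perm.iterate_eq_pow]
      exact Function.iterate_minimalPeriod
    choose! S hS1 hS2 hS3 hS4 using ih
    have hstep1 : ∀ i (hi : i < ts.length), ∀ y ∈ S i, M.FaceReach (x i) y := fun i hi y hy => by
      have := faceReach_next_mate (x i)
      exact this.trans (hS4 i hi y hy).1
    -- The tour of a subtree ends at its root `M.mate (x i)`; one more step along the face crosses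
    -- the edge back and arrives at `x (i + 1)`.
    have hstep2 : ∀ i (hi : i < ts.length), ∀ y ∈ S i, M.FaceReach y (x (i + 1)) :=
      fun i hi y hy => by
        have := faceReach_next_mate (M.mate (x i))
        rw [M.mate_mate, hxs] at this
        exact (hS4 i hi y hy).2.trans this
    have hfrom : ∀ i ≤ ts.length, M.FaceReach (M.next r) (x i) := by
      intro i
      induction i with
      | zero => intro _; rw [hx0]; exact faceReach_refl _
      | succ i ih =>
        intro hi
        exact (ih (by omega)).trans
          ((hstep1 i (by omega) _ (hS1 i (by omega))).trans (hstep2 i (by omega) _ (hS1 i (by omega))))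
    -- Here `j` is the number of subtrees still to be toured.
    have hto : ∀ j i, i + j = ts.length → M.FaceReach (x i) r := by
      intro j
      induction j with
      | zero =>
        rintro i hi
        rw [Nat.add_zero] at hi
        rw [hi, hxl]; exact faceReach_refl _
      | succ j ih =>
        intro i hi
        exact ((hstep1 i (by omega) _ (hS1 i (by omega))).trans
          (hstep2 i (by omega) _ (hS1 i (by omega)))).trans (ih (i + 1) (by omega))
    have hto' : ∀ i ≤ ts.length, M.FaceReach (x i) r :=
      fun i hi => hto (ts.length - i) i (by omega)
    refine ⟨{y | (∃ i ≤ ts.length, y = x i) ∨ ∃ i < ts.length, y ∈ S i},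
      .inl ⟨ts.length, le_rfl, hxl.symm⟩, ?_, ?_, ?_⟩
    · rintro y (⟨i, hi, rfl⟩ | ⟨i, hi, hy⟩)
      · left
        rcases hi.lt_or_eq with hi | rfl
        · exact ⟨i + 1, hi, hxs i⟩
        · exact ⟨0, by omega, by rw [hxl, hx0]⟩
      · exact .inr ⟨i, hi, hS2 i hi y hy⟩
    · rintro y (⟨i, hi, rfl⟩ | ⟨i, hi, hy⟩)
      · rcases hi.lt_or_eq with hi | rfl
        · exact .inr ⟨edges i hi, .inr ⟨i, hi, hS1 i hi⟩⟩
        · exact .inl hxl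
      · right
        rcases hS3 i hi y hy with rfl | ⟨h1, h2⟩
        · rw [M.mate_mate]
          exact ⟨(edges i hi).symm, .inl ⟨i, hi.le, rfl⟩⟩
        · exact ⟨h1, .inr ⟨i, hi, h2⟩⟩
    · rintro y (⟨i, hi, rfl⟩ | ⟨i, hi, hy⟩)
      · exact ⟨hfrom i hi, hto' i hi⟩
      · exact ⟨(hfrom i hi.le).trans (hstep1 i hi y hy),
          (hstep2 i hi y hy).trans (hto' (i + 1) hi)⟩

theorem mem_iff_of_joined {S : Set M.HalfEdge} (hnext : ∀ y ∈ S, M.next y ∈ S)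
    (hmate : ∀ y ∈ S, M.mate y ∈ S) {x y : M.HalfEdge} (h : M.Joined x y) : x ∈ S ↔ y ∈ S := by
  unfold Joined at h
  induction h with
  | rel x y h =>
    rcases h with rfl | rfl
    · refine ⟨hnext x, fun hx => ?_⟩
      -- The inverse of `next` is one of its powers, so forward closure gives backward closure.
      have hpow : ∀ k : ℕ, (M.next ^ k) (M.next x) ∈ S := by
        intro k
        induction k with
        | zero => exact hx
        | succ k ih => rw [pow_succ', Equiv.Perm.mul_apply]; exact hnext _ ih
      have := hpow (orderOf M.next - 1)
      rwa [← Equiv.Perm.mul_apply, ← pow_succ,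
        Nat.sub_add_cancel (orderOf_pos M.next), pow_orderOf_eq_one] at this
    · refine ⟨hmate x, fun hx => ?_⟩
      have := hmate _ hx
      rwa [M.mate_mate] at this
  | refl x => rfl
  | symm x y _ ih => exact ih.symm
  | trans x y z _ _ ih ih' => exact ih.trans ih'

theorem HasShape.isTree {r : M.HalfEdge} {t : PlaneTree} (h : M.HasShape r t)
    (hM : M.UniqueHeads) (hconn : ∀ x, M.Joined r x) (hr : M.isHead r = true)
    (hmate : M.mate r = r) : M.IsTree r := by
  obtain ⟨S, hrS, hnext, hmS, hreach⟩ := h.tour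
  have hS : ∀ x, x ∈ S := by
    intro x
    refine (mem_iff_of_joined hnext (fun y hy => ?_) (hconn x)).mp hrS
    rcases hmS y hy with rfl | ⟨-, h⟩
    · rwa [hmate]
    · exact h
  have hroot : ∀ x, M.mate x = x ↔ x = r := by
    intro x
    refine ⟨fun hx => ?_, fun hx => by rw [hx, hmate]⟩
    rcases hmS x (hS x) with h | ⟨h, -⟩
    · exact h
    · exact absurd hx h
  have hface : M.numFaces = 1 := by
    unfold numFaces
    rw [Nat.card_eq_one_iff_exists]
    refine ⟨Quotient.mk _ r, fun q => ?_⟩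
    induction q using Quotient.inductionOn with
    | h x =>
      obtain ⟨k, hk⟩ := (hreach x (hS x)).2
      exact Quotient.sound ⟨(k : ℤ), by rw [zpow_natCast]; exact hk⟩
  refine ⟨hconn, hroot, ?_, hface⟩
  rw [hface, hM.numVertices_eq, card_heads_eq_numEdges_add_one hr hroot]

theorem HasShape.isTreeAt {r : M.HalfEdge} {t : PlaneTree} (h : M.HasShape r t)
    (hM : M.UniqueHeads) (hr : M.isHead r = true) (hmate : M.mate r = r) : M.IsTreeAt r t := by
  have h' := h.component (Relation.EqvGen.refl r)
  refine ⟨h'.isTree (hM.component r) (fun x => ?_) hr (Subtype.ext hmate), h'⟩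
  exact component_joined x.2 _ _

/-- A tree has a single half-edge without an edge; this separates the components of different roots.
-/
theorem IsTreeAt.eq_of_joined {r r' : M.HalfEdge} {t : PlaneTree} (h : M.IsTreeAt r t)
    (hr' : M.mate r' = r') (hj : M.Joined r r') : r' = r :=
  congrArg Subtype.val ((h.1.root ⟨r', hj⟩).mp (Subtype.ext hr'))

end OrientedMap

/-! # The tour of the spanning tree -/

section tour

variable {w : List Letter}

/-- The half-edge with number `n`. -/
def halfEdge (w : List Letter) (n : ℕ) : HalfEdges w := Fin.ofNat _ n

theorem halfEdge_val {n : ℕ} (h : n ≤ (plus w).length) : (halfEdge w n).val = n :=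
  Nat.mod_eq_of_lt (by omega)

/-- The numbering is cyclic, so the root is also the half-edge met last, at time `(plus w).length`.
Its corner can then be treated like that of any other head. -/
theorem halfEdge_length_succ : halfEdge w ((plus w).length + 1) = 0 :=
  Fin.ext (by simp [halfEdge])

theorem halfEdge_succ (n : ℕ) : halfEdge w (n + 1) = halfEdge w n + 1 :=
  Fin.ext (by simp [halfEdge, Fin.val_add])

theorem eq_zero_or_halfEdge_succ (x : HalfEdges w) :
    x = 0 ∨ ∃ n < (plus w).length, x = halfEdge w (n + 1) := by
  obtain ⟨n, hn⟩ := x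
  rcases n with - | n
  · exact .inl rfl
  · exact .inr ⟨n, by omega, Fin.ext (halfEdge_val (by omega)).symm⟩

theorem lt_length_of_getElem? {s : List Letter} {n : ℕ} {l : Letter} (h : s[n]? = some l) :
    n < s.length :=
  (List.getElem?_eq_some_iff.mp h).1

theorem letterAt_zero : letterAt w 0 = none := rfl

theorem letterAt_halfEdge {n : ℕ} {l : Letter} (h : (plus w)[n]? = some l) :
    letterAt w (halfEdge w (n + 1)) = some l := by
  have := lt_length_of_getElem? h
  rw [letterAt, halfEdge_val (by omega), if_neg (by omega), Nat.add_sub_cancel, h]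

theorem Paired.linked {c d : Letter} {i j : ℕ} (h : Paired c d (plus w) i j) :
    Linked c d w (halfEdge w (i + 1)) (halfEdge w (j + 1)) := by
  have hj := lt_length_of_getElem? h.2.2.1
  have hij := h.1
  unfold Linked
  rw [halfEdge_val (by omega), halfEdge_val (by omega)]
  exact ⟨by omega, by omega, .inl h⟩

/-- The permutation `next` of the prefix-map. -/
def tourNext (w : List Letter) : Equiv.Perm (HalfEdges w) := finRotate _ * treeMate w

/-- The permutation `mate` of the prefix-map. -/
def tourMate (w : List Letter) : Equiv.Perm (HalfEdges w) := (prefixMap w).mate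

/-- Is `x` a head of the prefix-map? -/
def isHeadAt (w : List Letter) (x : HalfEdges w) : Bool := headLetter (letterAt w x)

theorem partner_eq {n : ℕ} {R : Fin n → Fin n → Prop} [DecidableRel R]
    (hu : ∀ x y z, R x y → R x z → y = z) {x y : Fin n} (h : R x y) : partner R x = y := by
  rcases partner_spec R x with h' | ⟨h', -⟩
  · exact hu _ _ _ h' h
  · exact absurd h (h' y)

theorem partner_eq_self {n : ℕ} {R : Fin n → Fin n → Prop} [DecidableRel R] {x : Fin n}
    (h : ∀ y, ¬ R x y) : partner R x = x := by
  rcases partner_spec R x with h' | ⟨-, h'⟩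
  · exact absurd h' (h _)
  · exact h'

theorem Linked.treeMate_eq {x y : HalfEdges w} (h : Linked .a .aBar w x y) : treeMate w x = y :=
  partner_eq (fun _ _ _ => Linked.unique (by decide)) h

theorem treeMate_eq_self {x : HalfEdges w} (h : letterAt w x ≠ some .a)
    (h' : letterAt w x ≠ some .aBar) : treeMate w x = x :=
  partner_eq_self fun _ hy => hy.letterAt.elim (fun e => h e.1) (fun e => h' e.1)

theorem treeMate_zero : treeMate w 0 = 0 :=
  treeMate_eq_self (by simp [letterAt_zero]) (by simp [letterAt_zero])

theorem LinkedAny.tourMate_eq {x y : HalfEdges w} (h : LinkedAny w x y) : tourMate w x = y :=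
  partner_eq LinkedAny.unique h

theorem tourMate_eq_self {x : HalfEdges w} (h : ∀ y, ¬ LinkedAny w x y) : tourMate w x = x :=
  partner_eq_self h

theorem tourNext_apply (x : HalfEdges w) : tourNext w x = treeMate w x + 1 :=
  finRotate_apply _

theorem tourNext_of_paired {i n : ℕ} (h : Paired .a .aBar (plus w) i n) :
    tourNext w (halfEdge w (i + 1)) = halfEdge w (n + 2) := by
  rw [tourNext_apply, h.linked.treeMate_eq, halfEdge_succ (n + 1)]

theorem tourNext_of_bBar {n : ℕ} (h : (plus w)[n]? = some .bBar) :
    tourNext w (halfEdge w (n + 1)) = halfEdge w (n + 2) := by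
  rw [tourNext_apply, treeMate_eq_self, halfEdge_succ (n + 1)] <;> simp [letterAt_halfEdge h]

/-! ### Open corners during the tour. -/

/-- One step of the tour. -/
def cornerStep {H : Type} (x : H) : Option Letter → List (H × List H) → List (H × List H)
  | some .a, R => (x, []) :: R
  | some .b, (p, _) :: R => (p, []) :: R
  | some .aBar, (p, _) :: (p', L') :: R => (p', L' ++ [p]) :: R
  | some .bBar, (p, L) :: R => (p, L ++ [x]) :: R
  | _, R => R

/-- The corners that are open once `n` letters have been written: for each edge of the spanning
tree followed only once, the last one first, and finally for the root, the half-edge opening it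
with the tails met around its end since the last head. -/
def corner (w : List Letter) : ℕ → List (HalfEdges w × List (HalfEdges w))
  | 0 => [(0, [])]
  | n + 1 => cornerStep (halfEdge w (n + 1)) (plus w)[n]? (corner w n)

/-- The tails of the first open corner. -/
def topTails {H : Type} : List (H × List H) → List H
  | [] => []
  | (_, L) :: _ => L

/-- The number of letters written before `x` is encountered, the root being encountered at the
end. -/
def time (w : List Letter) (x : HalfEdges w) : ℕ :=
  if x.val = 0 then (plus w).length else x.val - 1

/-- The tails between the head `x` and the previous head. -/
def kids (w : List Letter) (x : HalfEdges w) : List (HalfEdges w) := topTails (corner w (time w x))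

theorem time_zero : time w 0 = (plus w).length := rfl

theorem time_halfEdge {n : ℕ} (h : n < (plus w).length) : time w (halfEdge w (n + 1)) = n := by
  rw [time, halfEdge_val (by omega), if_neg (by omega), Nat.add_sub_cancel]

theorem time_le (x : HalfEdges w) : time w x ≤ (plus w).length := by
  rcases eq_zero_or_halfEdge_succ x with rfl | ⟨n, hn, rfl⟩
  · exact le_rfl
  · rw [time_halfEdge hn]; exact hn.le

theorem halfEdge_time_succ (x : HalfEdges w) : halfEdge w (time w x + 1) = x := by
  rcases eq_zero_or_halfEdge_succ x with rfl | ⟨n, hn, rfl⟩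
  · exact halfEdge_length_succ
  · rw [time_halfEdge hn]

theorem kids_halfEdge {n : ℕ} (h : n < (plus w).length) :
    kids w (halfEdge w (n + 1)) = topTails (corner w n) := by
  rw [kids, time_halfEdge h]

theorem corner_succ_of_a {n : ℕ} (h : (plus w)[n]? = some .a) :
    corner w (n + 1) = (halfEdge w (n + 1), []) :: corner w n := by
  rw [corner, h]; simp [cornerStep]

theorem corner_succ_of_b {n : ℕ} (h : (plus w)[n]? = some .b) {p L R}
    (hc : corner w n = (p, L) :: R) : corner w (n + 1) = (p, []) :: R := by
  rw [corner, h, hc]; rfl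

theorem corner_succ_of_aBar {n : ℕ} (h : (plus w)[n]? = some .aBar) {p L p' L' R}
    (hc : corner w n = (p, L) :: (p', L') :: R) : corner w (n + 1) = (p', L' ++ [p]) :: R := by
  rw [corner, h, hc]; rfl

theorem corner_succ_of_bBar {n : ℕ} (h : (plus w)[n]? = some .bBar) {p L R}
    (hc : corner w n = (p, L) :: R) :
    corner w (n + 1) = (p, L ++ [halfEdge w (n + 1)]) :: R := by
  rw [corner, h, hc]; rfl

theorem corner_succ_of_none {n : ℕ} (h : (plus w)[n]? = none) :
    corner w (n + 1) = corner w n := by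
  rw [corner, h]; simp [cornerStep]

/-- The corners are opened by the root and by the unpaired letters `a`. -/
theorem map_fst_corner (hw : IsPrefixShuffle w) (n : ℕ) :
    (corner w n).map Prod.fst =
      (stack .a .aBar (plus w) n).map (fun i => halfEdge w (i + 1)) ++ [0] := by
  induction n with
  | zero => rfl
  | succ n ih =>
    rcases h : (plus w)[n]? with - | l
    · rw [corner_succ_of_none h, stack_other (by simp [h]) (by simp [h]), ih]
    · cases l with
      | a => rw [corner_succ_of_a h, stack_open h, List.map_cons, ih]; rfl
      | aBar =>
        obtain ⟨i, l, hst⟩ := exists_stack_eq_cons (by decide) hw.balanced_a h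
        rw [hst] at ih
        rw [stack_close (by decide) h, hst]
        rcases hc : corner w n with - | ⟨⟨p, L⟩, - | ⟨⟨p', L'⟩, R⟩⟩
        · simp [hc] at ih
        · simp [hc] at ih
        · rw [hc] at ih
          rw [corner_succ_of_aBar h hc]
          simp only [List.map_cons, List.cons_append, List.cons.injEq] at ih
          simpa using ih.2
      | b =>
        rw [stack_other (by simp [h]) (by simp [h]), ← ih]
        rcases hc : corner w n with - | ⟨⟨p, L⟩, R⟩
        · simp [hc] at ih
        · rw [corner_succ_of_b h hc]; rfl
      | bBar =>
        rw [stack_other (by simp [h]) (by simp [h]), ← ih]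
        rcases hc : corner w n with - | ⟨⟨p, L⟩, R⟩
        · simp [hc] at ih
        · rw [corner_succ_of_bBar h hc]; rfl

theorem exists_corner_eq_cons (hw : IsPrefixShuffle w) (n : ℕ) :
    ∃ p L R, corner w n = (p, L) :: R := by
  have := map_fst_corner hw n
  rcases hc : corner w n with - | ⟨⟨p, L⟩, R⟩
  · simp [hc] at this
  · exact ⟨p, L, R, rfl⟩

theorem exists_corner_of_aBar (hw : IsPrefixShuffle w) {n : ℕ} (h : (plus w)[n]? = some .aBar) :
    ∃ i L p' L' R, i ∈ stack .a .aBar (plus w) n ∧ Paired .a .aBar (plus w) i n ∧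
      corner w n = (halfEdge w (i + 1), L) :: (p', L') :: R := by
  have := map_fst_corner hw n
  obtain ⟨i, l, hst⟩ := exists_stack_eq_cons (by decide) hw.balanced_a h
  rw [hst] at this
  rcases hc : corner w n with - | ⟨⟨p, L⟩, - | ⟨⟨p', L'⟩, R⟩⟩
  · simp [hc] at this
  · simp [hc] at this
  · simp only [hc, List.map_cons, List.cons_append, List.cons.injEq] at this
    refine ⟨i, L, p', L', R, by simp [hst], paired_of_stack_eq_cons (by decide) hst h, ?_⟩
    rw [this.1]

theorem corner_length (hw : IsPrefixShuffle w) : ∃ L, corner w (plus w).length = [(0, L)] := by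
  have := map_fst_corner hw (plus w).length
  rw [hw.stack_length_plus] at this
  rcases hc : corner w (plus w).length with - | ⟨⟨p, L⟩, - | ⟨e, R⟩⟩
  · simp [hc] at this
  · simp only [hc, List.map_cons, List.map_nil, List.nil_append, List.cons.injEq] at this
    exact ⟨L, by rw [this.1]⟩
  · simp [hc] at this

theorem mem_fst_corner (hw : IsPrefixShuffle w) {n : ℕ} {e} (he : e ∈ corner w n) :
    e.1 = 0 ∨ ∃ i ∈ stack .a .aBar (plus w) n, e.1 = halfEdge w (i + 1) := by
  have := List.mem_map_of_mem (f := Prod.fst) he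
  rw [map_fst_corner hw] at this
  simp only [List.mem_append, List.mem_map, List.mem_singleton] at this
  rcases this with ⟨i, hi, e⟩ | h
  · exact .inr ⟨i, hi, e.symm⟩
  · exact .inl h

/-! ### Corners as pieces of the vertices of the prefix-map. -/

/-- The tails of each corner of a list are consecutive around their vertex; the last one is
followed by `y` in the first corner, and by the half-edge opening the previous corner of the list
in the other ones. -/
def ChainedCorners (w : List Letter) :
    HalfEdges w → List (HalfEdges w × List (HalfEdges w)) → Prop
  | _, [] => True
  | y, (p, L) :: R => (L ++ [y]).IsChain (fun x y => tourNext w x = y) ∧ ChainedCorners w p R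

theorem isChain_concat {H : Type} {R : H → H → Prop} {L : List H} {x y : H}
    (h : (L ++ [x]).IsChain R) (hxy : R x y) : (L ++ [x] ++ [y]).IsChain R := by
  rw [List.append_assoc, List.singleton_append, List.isChain_append_cons_cons]
  exact ⟨h, hxy, List.isChain_singleton _⟩

/-- In the top corner the half-edge about to be met comes next. In a lower corner the tour left
through the tail opening the corner above, and returns just after that tail when the paired `ā` is
written. -/
theorem chainedCorners_corner (hw : IsPrefixShuffle w) {n : ℕ} (hn : n ≤ (plus w).length) :
    ChainedCorners w (halfEdge w (n + 1)) (corner w n) := by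
  induction n with
  | zero => exact ⟨List.isChain_singleton _, trivial⟩
  | succ n ih =>
    have ih := ih (by omega)
    have hl := List.getElem?_eq_getElem (l := plus w) (i := n) (by omega)
    generalize (plus w)[n] = l at hl
    cases l with
    | a =>
      rw [corner_succ_of_a hl]
      exact ⟨List.isChain_singleton _, ih⟩
    | aBar =>
      obtain ⟨i, L, p', L', R, -, hp, hc⟩ := exists_corner_of_aBar hw hl
      rw [corner_succ_of_aBar hl hc]
      rw [hc] at ih
      exact ⟨isChain_concat ih.2.1 (tourNext_of_paired hp), ih.2.2⟩
    | b =>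
      obtain ⟨p, L, R, hc⟩ := exists_corner_eq_cons hw n
      rw [corner_succ_of_b hl hc]
      rw [hc] at ih
      exact ⟨List.isChain_singleton _, ih.2⟩
    | bBar =>
      obtain ⟨p, L, R, hc⟩ := exists_corner_eq_cons hw n
      rw [corner_succ_of_bBar hl hc]
      rw [hc] at ih
      exact ⟨isChain_concat ih.1 (tourNext_of_bBar hl), ih.2⟩

theorem paired_b_of_bBar (hw : IsPrefixShuffle w) {n : ℕ} (h : (plus w)[n]? = some .bBar) :
    ∃ j l, stack .b .bBar (plus w) n = j :: l ∧ Paired .b .bBar (plus w) j n := by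
  obtain ⟨j, l, hst⟩ := exists_stack_eq_cons (by decide) hw.balanced_b h
  exact ⟨j, l, hst, paired_of_stack_eq_cons (by decide) hst h⟩

/-- The elements of the corners are tails of edges whose head has been encountered. -/
theorem corner_tails (hw : IsPrefixShuffle w) {n : ℕ} (hn : n ≤ (plus w).length) :
    ∀ e ∈ corner w n, ∀ x ∈ e.2, isHeadAt w x = false ∧
      ∃ k < n, tourMate w x = halfEdge w (k + 1) := by
  induction n with
  | zero => simp [corner]
  | succ n ih =>
    have ih : ∀ e ∈ corner w n, ∀ x ∈ e.2, isHeadAt w x = false ∧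
        ∃ k < n + 1, tourMate w x = halfEdge w (k + 1) := by
      intro e he x hx
      obtain ⟨h1, k, hk, h2⟩ := ih (by omega) e he x hx
      exact ⟨h1, k, by omega, h2⟩
    have hl := List.getElem?_eq_getElem (l := plus w) (i := n) (by omega)
    generalize (plus w)[n] = l at hl
    cases l with
    | a =>
      rw [corner_succ_of_a hl]
      simpa using ih
    | aBar =>
      obtain ⟨i, L, p', L', R, -, hp, hc⟩ := exists_corner_of_aBar hw hl
      rw [corner_succ_of_aBar hl hc]
      rw [hc] at ih
      simp only [List.forall_mem_cons] at ih
      simp only [List.forall_mem_cons, List.forall_mem_append]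
      refine ⟨⟨ih.2.1, ⟨?_, n, by omega, LinkedAny.tourMate_eq (.inl hp.linked)⟩, by simp⟩, ih.2.2⟩
      simp [isHeadAt, letterAt_halfEdge hp.2.1, headLetter]
    | b =>
      obtain ⟨p, L, R, hc⟩ := exists_corner_eq_cons hw n
      rw [corner_succ_of_b hl hc]
      rw [hc] at ih
      simp only [List.forall_mem_cons] at ih ⊢
      exact ⟨by simp, ih.2⟩
    | bBar =>
      obtain ⟨p, L, R, hc⟩ := exists_corner_eq_cons hw n
      obtain ⟨j, -, -, hp⟩ := paired_b_of_bBar hw hl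
      rw [corner_succ_of_bBar hl hc]
      rw [hc] at ih
      simp only [List.forall_mem_cons] at ih
      simp only [List.forall_mem_cons, List.forall_mem_append]
      refine ⟨⟨ih.1, ⟨?_, j, by have := hp.1; omega,
        LinkedAny.tourMate_eq (.inr hp.linked.symm)⟩, by simp⟩, ih.2⟩
      simp [isHeadAt, letterAt_halfEdge hl, headLetter]

/-- Every tail encountered opens a corner, lies in an open corner, or precedes a head. -/
theorem tail_location (hw : IsPrefixShuffle w) {n : ℕ} (hn : n ≤ (plus w).length) {m : ℕ}
    (hm : m < n) (ht : isHeadAt w (halfEdge w (m + 1)) = false) :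
    (∃ e ∈ corner w n, halfEdge w (m + 1) = e.1) ∨
      (∃ e ∈ corner w n, halfEdge w (m + 1) ∈ e.2) ∨
      ∃ h, isHeadAt w h = true ∧ halfEdge w (m + 1) ∈ kids w h := by
  induction n with
  | zero => omega
  | succ n ih =>
    have hl := List.getElem?_eq_getElem (l := plus w) (i := n) (by omega)
    generalize (plus w)[n] = l at hl
    have hhead : headLetter (some l) = true → isHeadAt w (halfEdge w (n + 1)) = true := by
      rw [isHeadAt, letterAt_halfEdge hl]
      exact id
    rcases Nat.lt_succ_iff_lt_or_eq.mp hm with hm | rfl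
    · have ih := ih (by omega) hm
      cases l with
      | a =>
        rw [corner_succ_of_a hl]
        rcases ih with ⟨e, he, h⟩ | ⟨e, he, h⟩ | h
        · exact .inl ⟨e, List.mem_cons_of_mem _ he, h⟩
        · exact .inr (.inl ⟨e, List.mem_cons_of_mem _ he, h⟩)
        · exact .inr (.inr h)
      | aBar =>
        have hk := kids_halfEdge (w := w) (n := n) (by omega)
        obtain ⟨i, L, p', L', R, -, hp, hc⟩ := exists_corner_of_aBar hw hl
        rw [corner_succ_of_aBar hl hc]
        rw [hc] at ih hk
        rcases ih with ⟨e, he, h⟩ | ⟨e, he, h⟩ | h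
        · rcases List.mem_cons.mp he with rfl | he
          -- The tail that opened the closed corner joins the corner below.
          · exact .inr (.inl ⟨_, List.mem_cons_self, by simp [h]⟩)
          · rcases List.mem_cons.mp he with rfl | he
            · exact .inl ⟨_, List.mem_cons_self, h⟩
            · exact .inl ⟨e, List.mem_cons_of_mem _ he, h⟩
        · rcases List.mem_cons.mp he with rfl | he
          -- The tails of the closed corner go to the head `ā` just met.
          · exact .inr (.inr ⟨_, hhead rfl, by rw [hk]; exact h⟩)
          · rcases List.mem_cons.mp he with rfl | he
            · exact .inr (.inl ⟨_, List.mem_cons_self, List.mem_append_left _ h⟩)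
            · exact .inr (.inl ⟨e, List.mem_cons_of_mem _ he, h⟩)
        · exact .inr (.inr h)
      | b =>
        have hk := kids_halfEdge (w := w) (n := n) (by omega)
        obtain ⟨p, L, R, hc⟩ := exists_corner_eq_cons hw n
        rw [corner_succ_of_b hl hc]
        rw [hc] at ih hk
        rcases ih with ⟨e, he, h⟩ | ⟨e, he, h⟩ | h
        · rcases List.mem_cons.mp he with rfl | he
          · exact .inl ⟨_, List.mem_cons_self, h⟩
          · exact .inl ⟨e, List.mem_cons_of_mem _ he, h⟩
        · rcases List.mem_cons.mp he with rfl | he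
          · exact .inr (.inr ⟨_, hhead rfl, by rw [hk]; exact h⟩)
          · exact .inr (.inl ⟨e, List.mem_cons_of_mem _ he, h⟩)
        · exact .inr (.inr h)
      | bBar =>
        obtain ⟨p, L, R, hc⟩ := exists_corner_eq_cons hw n
        rw [corner_succ_of_bBar hl hc]
        rw [hc] at ih
        rcases ih with ⟨e, he, h⟩ | ⟨e, he, h⟩ | h
        · rcases List.mem_cons.mp he with rfl | he
          · exact .inl ⟨_, List.mem_cons_self, h⟩
          · exact .inl ⟨e, List.mem_cons_of_mem _ he, h⟩
        · rcases List.mem_cons.mp he with rfl | he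
          · exact .inr (.inl ⟨_, List.mem_cons_self, List.mem_append_left _ h⟩)
          · exact .inr (.inl ⟨e, List.mem_cons_of_mem _ he, h⟩)
        · exact .inr (.inr h)
    · cases l with
      | a =>
        rw [corner_succ_of_a hl]
        exact .inl ⟨_, List.mem_cons_self, rfl⟩
      | aBar => rw [hhead rfl] at ht; simp at ht
      | b => rw [hhead rfl] at ht; simp at ht
      | bBar =>
        obtain ⟨p, L, R, hc⟩ := exists_corner_eq_cons hw m
        rw [corner_succ_of_bBar hl hc]
        exact .inr (.inl ⟨_, List.mem_cons_self, by simp⟩)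

theorem exists_mem_corner_kids (hw : IsPrefixShuffle w) (x : HalfEdges w) :
    ∃ e ∈ corner w (time w x), e.2 = kids w x := by
  obtain ⟨p, L, R, hc⟩ := exists_corner_eq_cons hw (time w x)
  exact ⟨(p, L), by simp [hc], by simp [kids, hc, topTails]⟩

theorem isCorners_kids (hw : IsPrefixShuffle w) :
    IsCorners (tourNext w) (isHeadAt w) (kids w) where
  chain h _ := by
    have := chainedCorners_corner hw (time_le h)
    obtain ⟨p, L, R, hc⟩ := exists_corner_eq_cons hw (time w h)
    rw [halfEdge_time_succ, hc] at this
    rw [kids, hc]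
    exact this.1
  tail h _ x hx := by
    obtain ⟨e, he, hk⟩ := exists_mem_corner_kids hw h
    exact (corner_tails hw (time_le h) e he x (hk ▸ hx)).1
  exists_mem x hx := by
    rcases eq_zero_or_halfEdge_succ x with rfl | ⟨n, hn, rfl⟩
    · simp [isHeadAt, letterAt_zero, headLetter] at hx
    · obtain ⟨L, hc⟩ := corner_length hw
      -- Only the corner of the root is open at the end of the tour. A half-edge of positive number
      -- does not open it, and the tails inside it belong to the root.
      rcases tail_location hw le_rfl hn hx with ⟨e, he, h⟩ | ⟨e, he, h⟩ | h
      · rw [hc, List.mem_singleton] at he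
        subst he
        have := congrArg Fin.val h
        rw [halfEdge_val (by omega)] at this
        simp at this
      · rw [hc, List.mem_singleton] at he
        subst he
        exact ⟨0, by simp [isHeadAt, letterAt_zero, headLetter],
          by rw [kids, time_zero, hc]; exact h⟩
      · exact h

/-- The edge of `x` joins `h` to a head met strictly earlier; passing from that head to `h` raises
the time, so such a climb terminates. -/
theorem time_lt_of_mem_kids (hw : IsPrefixShuffle w) {x h : HalfEdges w} (hx : x ∈ kids w h) :
    time w (tourMate w x) < time w h := by
  obtain ⟨e, he, hk⟩ := exists_mem_corner_kids hw h
  obtain ⟨-, k, hlt, hm⟩ := corner_tails hw (time_le h) e he x (hk ▸ hx)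
  rw [hm, time_halfEdge (hlt.trans_le (time_le h))]
  exact hlt

/-! ## Active edges -/

theorem isActiveTail_halfEdge (hw : IsPrefixShuffle w) {i : ℕ} (hi : i < (plus w).length) :
    isActiveTail w (halfEdge w (i + 1)) = true ↔ i ∈ stack .a .aBar (plus w) w.length := by
  rw [isActiveTail, decide_eq_true_iff, halfEdge_val (by omega), Nat.add_sub_cancel,
    nonPaired_iff_mem_stack (by decide) hw.balanced_a]
  simp

theorem letterAt_of_isActiveTail {x : HalfEdges w} (h : isActiveTail w x = true) :
    letterAt w x = some .a := by
  rw [isActiveTail, decide_eq_true_iff] at h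
  have hlt := lt_length_of_getElem? h.2.1
  rw [letterAt, if_neg (by omega), getElem?_plus_of_lt hlt, h.2.1]

theorem isHeadAt_of_isActiveTail {x : HalfEdges w} (h : isActiveTail w x = true) :
    isHeadAt w x = false := by
  rw [isHeadAt, letterAt_of_isActiveTail h]; rfl

theorem isActiveTail_eq_false_of_isHeadAt {x : HalfEdges w} (h : isHeadAt w x = true) :
    isActiveTail w x = false := by
  by_contra hx
  rw [Bool.not_eq_false] at hx
  rw [isHeadAt_of_isActiveTail hx] at h
  simp at h

theorem mem_stack_length_of_le (hw : IsPrefixShuffle w) {n i : ℕ} (hn : w.length ≤ n)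
    (hi : i ∈ stack .a .aBar (plus w) n) : i ∈ stack .a .aBar (plus w) w.length := by
  obtain ⟨h1, h2, h3⟩ := (mem_stack (by decide) hw.balanced_a).mp hi
  refine (mem_stack (by decide) hw.balanced_a).mpr ⟨?_, h2, fun j hj => h3 j (by omega)⟩
  by_contra hlt
  rw [getElem?_plus_of_le (by omega) (lt_length_of_getElem? h2)] at h2
  simp at h2

/-- The corners open at the end of `w` receive only tails of active edges. -/
theorem keep_kids_treeMate (hw : IsPrefixShuffle w) {n : ℕ} (hn : w.length ≤ n)
    (hn' : n ≤ (plus w).length) :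
    ∀ e ∈ corner w n,
      keep (isActiveTail w) (kids w (treeMate w e.1)) = keep (isActiveTail w) e.2 := by
  induction hn' using Nat.decreasingInduction with
  | self =>
    obtain ⟨L, hc⟩ := corner_length hw
    intro e he
    rw [hc, List.mem_singleton] at he
    subst he
    rw [treeMate_zero, kids, time_zero, hc]
    rfl
  | of_succ n hlt ih =>
    have hl := getElem?_plus_of_le hn hlt
    obtain ⟨i, L, p', L', R, hi, hp, hc⟩ := exists_corner_of_aBar hw hl
    have ih := ih (by omega)
    rw [corner_succ_of_aBar hl hc] at ih
    rw [hc]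
    simp only [List.forall_mem_cons] at ih ⊢
    refine ⟨?_, ?_, ih.2⟩
    -- The top corner is closed by the present `ā`, so its list is final.
    · rw [hp.linked.treeMate_eq, kids_halfEdge hlt, hc]
      rfl
    -- The corner below receives one more tail, whose `a` was unpaired at the end of `w`, and
    -- deletion removes it.
    · rw [ih.1, keep_append, keep_cons_of_eq_true]
      · simp [keep]
      · exact (isActiveTail_halfEdge hw (lt_length_of_getElem? hp.2.1)).mpr
          (mem_stack_length_of_le hw hn hi)

end tour

/-! # The prefix-forest -/

section forest

variable {w : List Letter}

/-- The half-edge of the prefix-forest coming from `x`. -/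
def forestHalfEdge (w : List Letter) (x : {x : HalfEdges w // isActiveTail w x = false}) :
    (prefixForest w).HalfEdge := x

theorem isActiveTail_origin (r : (prefixForest w).HalfEdge) :
    isActiveTail w (origin w r) = false := r.2

theorem origin_injective : Function.Injective (origin w) := fun _ _ h => Subtype.ext h

theorem isHead_forest (r : (prefixForest w).HalfEdge) :
    (prefixForest w).isHead r = isHeadAt w (origin w r) := rfl

theorem isCorners_forest (hw : IsPrefixShuffle w) :
    IsCorners ((prefixMap w).delete (isActiveTail w)).next
      ((prefixMap w).delete (isActiveTail w)).isHead
      (fun h => keep (isActiveTail w) (kids w h.1)) :=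
  IsCorners.delete (isCorners_kids hw) fun _ => isHeadAt_of_isActiveTail

theorem uniqueHeads_forest (hw : IsPrefixShuffle w) : (prefixForest w).UniqueHeads :=
  (isCorners_forest hw).uniqueHeads_explode

theorem mate_forest {x y : HalfEdges w} (hx : isActiveTail w x = false)
    (hy : isActiveTail w y = false) (h : tourMate w x = y) :
    (prefixForest w).mate (forestHalfEdge w ⟨x, hx⟩) = forestHalfEdge w ⟨y, hy⟩ := by
  subst h
  exact OrientedMap.delete_mate_of_eq_false (M := prefixMap w) (x := ⟨x, hx⟩) hy

theorem mate_forest_eq_self {x : HalfEdges w} (hx : isActiveTail w x = false)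
    (h : isActiveTail w (tourMate w x) = true) :
    (prefixForest w).mate (forestHalfEdge w ⟨x, hx⟩) = forestHalfEdge w ⟨x, hx⟩ :=
  OrientedMap.delete_mate_of_eq_true (M := prefixMap w) (x := ⟨x, hx⟩) h

/-- Exploring the prefix-forest from the half-edge coming from `x` one finds the tree `t`. -/
def Shaped (w : List Letter) (x : HalfEdges w) (t : PlaneTree) : Prop :=
  ∃ r : (prefixForest w).HalfEdge, origin w r = x ∧ (prefixForest w).HasShape r t

/-- The tails of a list that belong to the prefix-forest carry the sons of the root of `t`. -/
def CarriesSons (w : List Letter) (L : List (HalfEdges w)) (t : PlaneTree) : Prop :=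
  ∃ us, t = .node us ∧ (prefixForest w).Carries (keep (isActiveTail w) L) us

theorem carriesSons_nil : CarriesSons w [] .τ :=
  ⟨[], rfl, List.Forall₂.nil⟩

theorem CarriesSons.shaped (hw : IsPrefixShuffle w) {x : HalfEdges w} (hx : isHeadAt w x = true)
    {t : PlaneTree} (h : CarriesSons w (kids w x) t) : Shaped w x t := by
  obtain ⟨us, rfl, h⟩ := h
  refine ⟨forestHalfEdge w ⟨x, isActiveTail_eq_false_of_isHeadAt hx⟩, rfl, ?_⟩
  exact (isCorners_forest hw).hasShape_explode
    (h := forestHalfEdge w ⟨x, isActiveTail_eq_false_of_isHeadAt hx⟩) hx h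

/-- The new tail comes last in the list, just as `σ` adds its first argument as the last son. -/
theorem CarriesSons.concat {L : List (HalfEdges w)} {x y : HalfEdges w} {t₁ t₂ : PlaneTree}
    (h : CarriesSons w L t₂) (hx : isActiveTail w x = false) (hxy : x ≠ y)
    (hm : tourMate w x = y) (ht : Shaped w y t₁) :
    CarriesSons w (L ++ [x]) (.σ t₁ t₂) := by
  obtain ⟨us, rfl, h⟩ := h
  obtain ⟨r, hr, ht⟩ := ht
  have hy : isActiveTail w y = false := hr ▸ isActiveTail_origin r
  have hm' := mate_forest hx hy hm
  have hr' : forestHalfEdge w ⟨y, hy⟩ = r := origin_injective hr.symm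
  refine ⟨us ++ [t₁], rfl, ?_⟩
  rw [keep_append, keep_cons_of_eq_false hx]
  refine List.rel_append h (List.Forall₂.cons ⟨fun e => hxy ?_, ?_⟩ List.Forall₂.nil)
  · exact congrArg (origin w) (e.symm.trans hm')
  · have : (prefixForest w).HasShape ((prefixForest w).mate (forestHalfEdge w ⟨x, hx⟩)) t₁ := by
      rw [hm', hr']; exact ht
    exact this

theorem isHeadAt_halfEdge {n : ℕ} {l : Letter} (h : (plus w)[n]? = some l) :
    isHeadAt w (halfEdge w (n + 1)) = headLetter (some l) := by
  rw [isHeadAt, letterAt_halfEdge h]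

theorem isActiveTail_of_letter {n : ℕ} {l : Letter} (h : (plus w)[n]? = some l) (hl : l ≠ .a) :
    isActiveTail w (halfEdge w (n + 1)) = false := by
  by_contra hx
  rw [Bool.not_eq_false] at hx
  have := letterAt_of_isActiveTail hx
  rw [letterAt_halfEdge h] at this
  exact hl (Option.some_injective _ this)

/-- The tree-sequence of a prefix of `w` describes the trees of the prefix-forest under
construction. -/
theorem lambda0_take (hw : IsPrefixShuffle w) {n : ℕ} (hn : n ≤ w.length) :
    ∃ ts ts', lambda0 (w.take n) = treeSequence ts.reverse ts'.reverse ∧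
      List.Forall₂ (fun i t => Shaped w (halfEdge w (i + 1)) t) (stack .b .bBar (plus w) n) ts ∧
      List.Forall₂ (fun e t => CarriesSons w e.2 t) (corner w n) ts' := by
  induction n with
  | zero => exact ⟨[], [.τ], rfl, .nil, .cons carriesSons_nil .nil⟩
  | succ n ih =>
    obtain ⟨ts, ts', hlam, hb, ha⟩ := ih (by omega)
    have hlw : n < w.length := by omega
    have hlp : n < (plus w).length := hlw.trans_le (length_le_length_plus w)
    have hl : (plus w)[n]? = some w[n] := by
      rw [getElem?_plus_of_lt hlw, List.getElem?_eq_getElem hlw]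
    rw [List.take_succ_eq_append_getElem hlw, lambda0_append_singleton, hlam]
    generalize w[n] = l at hl
    cases l with
    | a =>
      rw [corner_succ_of_a hl, stack_other (by simp [hl]) (by simp [hl])]
      refine ⟨ts, .τ :: ts', ?_, hb, .cons carriesSons_nil ha⟩
      rw [treeSequence_a, List.reverse_cons]
    | b =>
      obtain ⟨p, L, R, hc⟩ := exists_corner_eq_cons hw n
      have hk := kids_halfEdge hlp
      rw [corner_succ_of_b hl hc, stack_open hl]
      rw [hc] at ha hk
      obtain ⟨t, ts', ht, ha', rfl⟩ := List.forall₂_cons_left_iff.mp ha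
      refine ⟨t :: ts, .τ :: ts', ?_, .cons ?_ hb, .cons carriesSons_nil ha'⟩
      · rw [List.reverse_cons, treeSequence_b, List.reverse_cons, List.reverse_cons]
      -- The tails of the top corner are exactly those owned by this head `b`, so its tree is
      -- finished.
      · exact CarriesSons.shaped hw (isHeadAt_halfEdge hl) (by rw [hk]; exact ht)
    | aBar =>
      obtain ⟨i, L, p', L', R, -, hp, hc⟩ := exists_corner_of_aBar hw hl
      have hk := kids_halfEdge hlp
      rw [corner_succ_of_aBar hl hc, stack_other (by simp [hl]) (by simp [hl])]
      rw [hc] at ha hk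
      obtain ⟨t₁, ts', ht₁, ha', rfl⟩ := List.forall₂_cons_left_iff.mp ha
      obtain ⟨t₂, ts', ht₂, ha'', rfl⟩ := List.forall₂_cons_left_iff.mp ha'
      refine ⟨ts, .σ t₁ t₂ :: ts', ?_, hb, .cons ?_ ha''⟩
      · have := treeSequence_aBar ts.reverse ts'.reverse t₁ t₂
        simpa using this
      · have hhead := isHeadAt_halfEdge hl
        refine ht₂.concat (y := halfEdge w (n + 1)) ?_ ?_ (LinkedAny.tourMate_eq (.inl hp.linked))
          (CarriesSons.shaped hw hhead (by rw [hk]; exact ht₁))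
        -- The partner `ā` lies inside `w`, so the edge is not active and its tail survives
        -- deletion.
        · by_contra hact
          rw [Bool.not_eq_false, isActiveTail_halfEdge hw (lt_length_of_getElem? hp.2.1),
            mem_stack (by decide) hw.balanced_a] at hact
          exact hact.2.2 n hlw hp
        · intro e
          rw [← e, isHeadAt_halfEdge hp.2.1] at hhead
          simp [headLetter] at hhead
    | bBar =>
      obtain ⟨p, L, R, hc⟩ := exists_corner_eq_cons hw n
      obtain ⟨j, l, hst, hp⟩ := paired_b_of_bBar hw hl
      rw [corner_succ_of_bBar hl hc, stack_close (by decide) hl, hst, List.tail_cons]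
      rw [hc] at ha
      rw [hst] at hb
      obtain ⟨t₁, ts, ht₁, hb', rfl⟩ := List.forall₂_cons_left_iff.mp hb
      obtain ⟨t₂, ts', ht₂, ha', rfl⟩ := List.forall₂_cons_left_iff.mp ha
      refine ⟨ts, .σ t₁ t₂ :: ts', ?_, hb', .cons ?_ ha'⟩
      · rw [List.reverse_cons, List.reverse_cons, treeSequence_bBar, List.reverse_cons]
      · refine ht₂.concat (isActiveTail_of_letter hl (by decide)) ?_
          (LinkedAny.tourMate_eq (.inr hp.linked.symm)) ht₁
        intro e
        have := isHeadAt_halfEdge hp.2.1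
        rw [← e, isHeadAt_halfEdge hl] at this
        simp [headLetter] at this

/-! ## The roots -/

/-- Both lists are strictly increasing and have the same elements; the stack holds the latest
position first, whence the reversal. -/
theorem filter_nonPaired {c d : Letter} (hcd : c ≠ d) (hs : Balanced c d (plus w)) :
    (List.finRange ((plus w).length + 1)).filter
        (fun x : HalfEdges w => decide (0 < x.val ∧ NonPaired c d w (x.val - 1))) =
      (stack c d (plus w) w.length).reverse.map (fun i => halfEdge w (i + 1)) := by
  have hlt : ∀ i ∈ stack c d (plus w) w.length, i + 1 ≤ (plus w).length := fun i hi =>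
    (lt_of_mem_stack hi).trans_le (length_le_length_plus w)
  refine List.Pairwise.eq_of_mem_iff (r := (· < ·)) ?_ ?_ ?_
  · exact (List.pairwise_lt_finRange _).filter _
  · rw [List.pairwise_map, List.pairwise_reverse]
    refine (stack_pairwise _).imp_of_mem fun {i j} hi hj hij => ?_
    rw [Fin.lt_def, halfEdge_val (hlt j hj), halfEdge_val (hlt i hi)]
    exact Nat.succ_lt_succ hij
  · intro x
    simp only [List.mem_filter, List.mem_finRange, true_and, decide_eq_true_iff, List.mem_map,
      List.mem_reverse, nonPaired_iff_mem_stack hcd hs]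
    constructor
    · rintro ⟨h1, h2⟩
      refine ⟨_, h2, Fin.ext ?_⟩
      rw [halfEdge_val (hlt _ h2)]
      omega
    · rintro ⟨i, hi, rfl⟩
      rw [halfEdge_val (hlt i hi), Nat.add_sub_cancel]
      exact ⟨by omega, hi⟩

theorem danglingHeads_eq (hw : IsPrefixShuffle w) : danglingHeads w =
    (stack .b .bBar (plus w) w.length).reverse.map (fun i => halfEdge w (i + 1)) :=
  filter_nonPaired (by decide) hw.balanced_b

/-- Besides the root, the corners open at the end of `w` are opened by the active tails, and
`treeMate` sends an active tail to its head while fixing the root. Reversal brings the root to the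
front. -/
theorem rootingHeads_eq (hw : IsPrefixShuffle w) :
    rootingHeads w = (corner w w.length).reverse.map (fun e => treeMate w e.1) := by
  have h := congrArg (fun l => l.reverse.map (treeMate w)) (map_fst_corner hw w.length)
  simp only [← List.map_reverse, List.map_map] at h
  refine Eq.trans ?_ h.symm
  rw [List.reverse_append, List.reverse_singleton, List.singleton_append, List.map_cons,
    treeMate_zero, ← List.map_reverse, ← filter_nonPaired (by decide) hw.balanced_a]
  rfl

theorem mem_danglingHeads {x : HalfEdges w} : x ∈ danglingHeads w ↔ isDanglingHead w x = true := by
  simp [danglingHeads]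

theorem mem_rootingHeads {x : HalfEdges w} :
    x ∈ rootingHeads w ↔ x = 0 ∨ ∃ y, isActiveTail w y = true ∧ treeMate w y = x := by
  simp [rootingHeads]

theorem letterAt_of_isDanglingHead {x : HalfEdges w} (h : isDanglingHead w x = true) :
    letterAt w x = some .b := by
  rw [isDanglingHead, decide_eq_true_iff] at h
  have hlt := lt_length_of_getElem? h.2.1
  rw [letterAt, if_neg (by omega), getElem?_plus_of_lt hlt, h.2.1]

/-- The completion of `w` consists of letters `ā` only and cannot pair a `b`. -/
theorem tourMate_of_isDanglingHead {x : HalfEdges w}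
    (h : isDanglingHead w x = true) : tourMate w x = x := by
  have hb := letterAt_of_isDanglingHead h
  refine tourMate_eq_self fun y hy => ?_
  rcases hy with hy | hy
  · rcases hy.letterAt with e | e <;> simp [hb] at e
  · rw [isDanglingHead, decide_eq_true_iff] at h
    rcases hy.2.2 with hp | hp
    · have hlt : y.val - 1 < w.length := by
        by_contra hge
        have := hp.2.2.1
        rw [getElem?_plus_of_le (by omega) (lt_length_of_getElem? this)] at this
        simp at this
      exact h.2.2 _ (List.mem_range.mpr hlt) ((paired_plus_iff _ _ hlt).mp hp)
    · have := hp.2.2.1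
      rw [letterAt, if_neg (by omega), this] at hb
      simp at hb

theorem exists_linked_of_isActiveTail (hw : IsPrefixShuffle w) {y : HalfEdges w}
    (h : isActiveTail w y = true) :
    Linked .a .aBar w y (treeMate w y) ∧ letterAt w (treeMate w y) = some .aBar := by
  have ha := letterAt_of_isActiveTail h
  have hl : Linked .a .aBar w y (treeMate w y) := by
    rcases partner_spec (Linked .a .aBar w) y with hl | ⟨hl, -⟩
    · exact hl
    · exfalso
      rcases eq_zero_or_halfEdge_succ y with rfl | ⟨i, hi, rfl⟩
      · simp [letterAt_zero] at ha
      · have hmem : i ∉ stack .a .aBar (plus w) (plus w).length := by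
          rw [hw.stack_length_plus]; simp
        rw [mem_stack (by decide) hw.balanced_a] at hmem
        push Not at hmem
        rw [letterAt, halfEdge_val (by omega), if_neg (by omega), Nat.add_sub_cancel] at ha
        obtain ⟨j, -, hp⟩ := hmem hi ha
        exact hl _ hp.linked
  refine ⟨hl, ?_⟩
  rcases hl.letterAt with e | e
  · exact e.2
  · rw [ha] at e; simp at e

theorem tourMate_zero : tourMate w 0 = 0 :=
  tourMate_eq_self fun y hy => by
    rcases hy with hy | hy <;> exact absurd hy.1 (lt_irrefl _)

/-- The dangling heads and the rooting heads are roots of the prefix-forest. -/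
theorem root_spec (hw : IsPrefixShuffle w) {r : (prefixForest w).HalfEdge}
    (h : origin w r ∈ danglingHeads w ++ rootingHeads w) :
    (prefixForest w).isHead r = true ∧ (prefixForest w).mate r = r := by
  rw [List.mem_append, mem_danglingHeads, mem_rootingHeads] at h
  have hr := isActiveTail_origin r
  rcases h with h | h | ⟨y, hy, h⟩
  · refine ⟨?_, mate_forest hr hr (tourMate_of_isDanglingHead h)⟩
    rw [isHead_forest, isHeadAt, letterAt_of_isDanglingHead h]
    rfl
  · refine ⟨?_, mate_forest hr hr (by rw [h, tourMate_zero])⟩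
    rw [isHead_forest, h, isHeadAt, letterAt_zero]
    rfl
  · obtain ⟨h1, h2⟩ := exists_linked_of_isActiveTail hw hy
    rw [h] at h1 h2
    refine ⟨?_, mate_forest_eq_self hr ?_⟩
    · rw [isHead_forest, isHeadAt, h2]
      rfl
    · rw [LinkedAny.tourMate_eq (.inl h1.symm), hy]

theorem Shaped.isTreeAt (hw : IsPrefixShuffle w) {x : HalfEdges w} {t : PlaneTree}
    (h : Shaped w x t) (hx : x ∈ danglingHeads w ++ rootingHeads w) :
    ∃ r : (prefixForest w).HalfEdge, origin w r = x ∧ (prefixForest w).IsTreeAt r t := by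
  obtain ⟨r, rfl, h⟩ := h
  obtain ⟨h1, h2⟩ := root_spec hw hx
  exact ⟨r, rfl, h.isTreeAt (uniqueHeads_forest hw) h1 h2⟩

/-- The letters tell the kinds of roots apart: `b` at a dangling head, `ā` at the head of an active
edge, none at the root. -/
theorem nodup_roots (hw : IsPrefixShuffle w) : (danglingHeads w ++ rootingHeads w).Nodup := by
  refine List.Nodup.append ((List.nodup_finRange _).filter _) (List.nodup_cons.mpr ⟨?_, ?_⟩) ?_
  · intro h
    obtain ⟨y, hy, h⟩ := List.mem_map.mp h
    have := (exists_linked_of_isActiveTail hw (List.mem_filter.mp hy).2).2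
    rw [h, letterAt_zero] at this
    simp at this
  · exact ((List.nodup_finRange _).filter _).map (treeMate w).injective
  · intro x hx hx'
    have hb := letterAt_of_isDanglingHead (mem_danglingHeads.mp hx)
    rcases mem_rootingHeads.mp hx' with rfl | ⟨y, hy, rfl⟩
    · simp [letterAt_zero] at hb
    · rw [(exists_linked_of_isActiveTail hw hy).2] at hb
      simp at hb

/-! ### Connected components of the prefix-forest. -/

/-- A head that is not a root is the head of an edge of the prefix-forest. -/
theorem root_or_exists_tail (hw : IsPrefixShuffle w) {x : HalfEdges w}
    (hx : isHeadAt w x = true) : x ∈ danglingHeads w ++ rootingHeads w ∨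
      ∃ y, isActiveTail w y = false ∧ isHeadAt w y = false ∧ tourMate w y = x := by
  rw [List.mem_append, mem_danglingHeads, mem_rootingHeads]
  rcases eq_zero_or_halfEdge_succ x with rfl | ⟨n, hn, rfl⟩
  · exact .inl (.inr (.inl rfl))
  · have hl := List.getElem?_eq_getElem hn
    generalize (plus w)[n] = l at hl
    rw [isHeadAt_halfEdge hl] at hx
    cases l with
    | a => simp [headLetter] at hx
    | bBar => simp [headLetter] at hx
    | aBar =>
      obtain ⟨i, -, -, -, -, -, hp, -⟩ := exists_corner_of_aBar hw hl
      cases hact : isActiveTail w (halfEdge w (i + 1)) with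
      | true => exact .inl (.inr (.inr ⟨_, hact, hp.linked.treeMate_eq⟩))
      | false =>
        exact .inr ⟨_, hact, by rw [isHeadAt_halfEdge hp.2.1]; rfl,
          LinkedAny.tourMate_eq (.inl hp.linked)⟩
    | b =>
      by_cases hd : isDanglingHead w (halfEdge w (n + 1)) = true
      · exact .inl (.inl hd)
      · right
        have hnw : n < w.length := by
          by_contra hge
          rw [getElem?_plus_of_le (by omega) hn] at hl
          simp at hl
        rw [isDanglingHead, decide_eq_true_iff, halfEdge_val (by omega), Nat.add_sub_cancel,
          nonPaired_iff_mem_stack (by decide) hw.balanced_b,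
          mem_stack (by decide) hw.balanced_b] at hd
        push Not at hd
        obtain ⟨j, -, hp⟩ := hd (by omega) hnw hl
        exact ⟨_, isActiveTail_of_letter hp.2.2.1 (by decide),
          by rw [isHeadAt_halfEdge hp.2.2.1]; rfl, LinkedAny.tourMate_eq (.inr hp.linked.symm)⟩

theorem OrientedMap.joined_of_sameCycle {M : OrientedMap} {x y : M.HalfEdge}
    (h : M.next.SameCycle x y) : M.Joined x y := by
  obtain ⟨k, rfl⟩ := h.exists_nat_pow_eq
  induction k with
  | zero => exact .refl _
  | succ k ih =>
    rw [pow_succ', Equiv.Perm.mul_apply]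
    exact (M.joined_next_iff _ _).mpr (ih ⟨k, by simp⟩)

theorem joined_of_mem_kids (hw : IsPrefixShuffle w) {h x : HalfEdges w}
    (hh : isActiveTail w h = false) (hhead : isHeadAt w h = true) (hx : isActiveTail w x = false)
    (hmem : x ∈ kids w h) :
    (prefixForest w).Joined (forestHalfEdge w ⟨h, hh⟩) (forestHalfEdge w ⟨x, hx⟩) := by
  have hmem' : (⟨x, hx⟩ : {x // isActiveTail w x = false}) ∈ keep (isActiveTail w) (kids w h) :=
    mem_keep.mpr hmem
  obtain ⟨i, hi, e⟩ := List.getElem_of_mem hmem'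
  have := (isCorners_forest hw).explode_pow (h := forestHalfEdge w ⟨h, hh⟩) hhead hi
  exact OrientedMap.joined_of_sameCycle ⟨(i + 1 : ℕ), by
    rw [zpow_natCast]; exact this.trans e⟩

/-- Unless the head is a root, its edge leads to a tail owned by a later head. The time cannot
exceed `(plus w).length`, so `m`, the time left, decreases until a root is reached. -/
theorem exists_root_joined_head (hw : IsPrefixShuffle w) (m : ℕ) :
    ∀ x (hx : isActiveTail w x = false), isHeadAt w x = true → (plus w).length - time w x = m →
      ∃ r : (prefixForest w).HalfEdge, origin w r ∈ danglingHeads w ++ rootingHeads w ∧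
        (prefixForest w).Joined r (forestHalfEdge w ⟨x, hx⟩) := by
  induction m using Nat.strong_induction_on with
  | _ m ih =>
    intro x hx hhead hm
    rcases root_or_exists_tail hw hhead with h | ⟨y, hy, hyt, rfl⟩
    · exact ⟨forestHalfEdge w ⟨x, hx⟩, h, .refl _⟩
    · obtain ⟨h, hh, hyh⟩ := (isCorners_kids hw).exists_mem y hyt
      have ht := time_lt_of_mem_kids hw hyh
      have hle := time_le h
      have hh' := isActiveTail_eq_false_of_isHeadAt hh
      obtain ⟨r, hr, hj⟩ := ih ((plus w).length - time w h) (by omega) h hh' hh rfl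
      refine ⟨r, hr, ?_⟩
      rw [← mate_forest hy hx rfl]
      exact (OrientedMap.joined_mate_iff _ _ _).mpr
        (hj.trans _ _ _ (joined_of_mem_kids hw hh' hh hy hyh))

theorem exists_root_joined (hw : IsPrefixShuffle w) (x : (prefixForest w).HalfEdge) :
    ∃ r : (prefixForest w).HalfEdge, origin w r ∈ danglingHeads w ++ rootingHeads w ∧
      (prefixForest w).Joined r x := by
  obtain ⟨h, hh, hs⟩ := (uniqueHeads_forest hw).exists_head x
  obtain ⟨r, hr, hj⟩ := exists_root_joined_head hw _ (origin w h) (isActiveTail_origin h) hh rfl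
  exact ⟨r, hr, hj.trans _ _ _ (OrientedMap.joined_of_sameCycle hs)⟩

theorem forall₂_map_left_of_mem {α β γ : Type} {R : α → γ → Prop} {S : β → γ → Prop} {f : α → β}
    {l : List α} {ts : List γ} (h : List.Forall₂ R l ts)
    (hRS : ∀ e ∈ l, ∀ t, R e t → S (f e) t) : List.Forall₂ S (l.map f) ts := by
  induction h with
  | nil => exact .nil
  | cons h _ ih =>
    exact .cons (hRS _ List.mem_cons_self _ h)
      (ih fun e he => hRS e (List.mem_cons_of_mem _ he))

theorem exists_of_mem_forall₂ {α γ : Type} {R : α → γ → Prop} {l : List α} {ts : List γ}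
    (h : List.Forall₂ R l ts) {x : α} (hx : x ∈ l) : ∃ t, R x t := by
  induction h with
  | nil => simp at hx
  | cons h _ ih =>
    rcases List.mem_cons.mp hx with rfl | hx
    · exact ⟨_, h⟩
    · exact ih hx

theorem isHeadAt_treeMate_of_mem_corner (hw : IsPrefixShuffle w) {e}
    (he : e ∈ corner w w.length) : isHeadAt w (treeMate w e.1) = true := by
  rcases mem_fst_corner hw he with h | ⟨i, hi, h⟩
  · rw [h, treeMate_zero]; rfl
  · have hact := (isActiveTail_halfEdge hw
      ((lt_of_mem_stack hi).trans_le (length_le_length_plus w))).mpr hi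
    rw [h, isHeadAt, (exists_linked_of_isActiveTail hw hact).2]
    rfl

end forest

end PrefixShuffle

/-! ### The proposition. -/

theorem mainTheorem5 (w : List PrefixShuffle.Letter) (hw : PrefixShuffle.IsPrefixShuffle w) :
    ∃ ts ts' : List PrefixShuffle.PlaneTree,
      -- the component of the `i`-th dangling head, rooted at this head, is the tree `t_i`
      List.Forall₂ (fun h t => ∃ r : (PrefixShuffle.prefixForest w).HalfEdge,
          PrefixShuffle.origin w r = h ∧ (PrefixShuffle.prefixForest w).IsTreeAt r t)
        (PrefixShuffle.danglingHeads w) ts ∧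
      -- the component of the `i`-th rooting head, rooted at this head, is the tree `t'_i`
      List.Forall₂ (fun h t => ∃ r : (PrefixShuffle.prefixForest w).HalfEdge,
          PrefixShuffle.origin w r = h ∧ (PrefixShuffle.prefixForest w).IsTreeAt r t)
        (PrefixShuffle.rootingHeads w) ts' ∧
      -- these are `k + l` distinct components, and there is no other one
      (PrefixShuffle.danglingHeads w ++ PrefixShuffle.rootingHeads w).Nodup ∧
      (∀ x : (PrefixShuffle.prefixForest w).HalfEdge,
        ∃! r : (PrefixShuffle.prefixForest w).HalfEdge,
          PrefixShuffle.origin w r ∈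
            PrefixShuffle.danglingHeads w ++ PrefixShuffle.rootingHeads w ∧
          (PrefixShuffle.prefixForest w).Joined r x) ∧
      PrefixShuffle.lambda0 w = PrefixShuffle.treeSequence ts ts' := by
  open PrefixShuffle in
  obtain ⟨ts, ts', hlam, hb, ha⟩ := lambda0_take hw le_rfl
  rw [List.take_length] at hlam
  have hD : List.Forall₂ (fun h t => ∃ r : (prefixForest w).HalfEdge,
      origin w r = h ∧ (prefixForest w).IsTreeAt r t) (danglingHeads w) ts.reverse := by
    have heq := danglingHeads_eq hw
    rw [heq]
    refine forall₂_map_left_of_mem (List.forall₂_reverse_iff.mpr hb) fun i hi t ht =>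
      ht.isTreeAt hw (List.mem_append_left _ ?_)
    rw [heq]
    exact List.mem_map_of_mem hi
  have hR : List.Forall₂ (fun h t => ∃ r : (prefixForest w).HalfEdge,
      origin w r = h ∧ (prefixForest w).IsTreeAt r t) (rootingHeads w) ts'.reverse := by
    have heq := rootingHeads_eq hw
    rw [heq]
    refine forall₂_map_left_of_mem (List.forall₂_reverse_iff.mpr ha) fun e he t ht => ?_
    have he' := List.mem_reverse.mp he
    -- After deletion, the head closing this corner owns just the tails already present at the end
    -- of `w`.
    have hkeep := keep_kids_treeMate hw le_rfl (length_le_length_plus w) e he'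
    refine Shaped.isTreeAt hw (CarriesSons.shaped hw (isHeadAt_treeMate_of_mem_corner hw he') ?_)
      (List.mem_append_right _ ?_)
    · obtain ⟨us, hus, hc⟩ := ht
      exact ⟨us, hus, by rw [hkeep]; exact hc⟩
    · rw [heq]
      exact List.mem_map_of_mem (f := fun e => treeMate w e.1) he
  refine ⟨ts.reverse, ts'.reverse, hD, hR, nodup_roots hw, fun x => ?_, hlam⟩
  obtain ⟨r, hr, hj⟩ := exists_root_joined hw x
  refine ⟨r, ⟨hr, hj⟩, fun r' ⟨hr', hj'⟩ => ?_⟩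
  -- The component of `r` is a tree rooted at `r`, and `r'` is a dangling half-edge in it.
  obtain ⟨t, r₀, h₀, ht⟩ := exists_of_mem_forall₂ (List.rel_append hD hR) hr
  rw [origin_injective h₀] at ht
  exact ht.eq_of_joined (root_spec hw hr').2 (hj.trans _ _ _ (hj'.symm _ _))
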